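/- Let $q\in(-\infty,1)$ and $n,d\in\mathbb N$, let $\mathcal X=\{x\in\mathbb R^n: g_j(x)\ge 0,\ j=1,\dots,m\}$, with real polynomials $g_1,\dots,g_m$ in $n$ variables, be compact with nonempty interior. For $k\in\mathbb N$ let $\mathcal M_k(\mathcal X)$ be the set of all vectors $\mathbf y=(y_\alpha)_{\alpha\in\mathbb N^n,\,|\alpha|\le k}$ such that $y_\alpha=\int x^\alpha\,d\mu$ for all $|\alpha|\le k$, for some finite Borel measure $\mu$ supported on $\mathcal X$. For $\mathbf y=(y_\alpha)_{|\alpha|\le 2d}$ let $M_d(\mathbf y)=(y_{\alpha+\beta})_{|\alpha|,|\beta|\le d}$, and let $\mathbf v_d(x)=(x^\alpha)_{|\alpha|\le d}$. For a positive semidefinite matrix $M$ of size $p=\binom{n+d}{n}$ let $\phi_q(M)=\big(\tfrac1p\,\mathrm{trace}(M^q)\big)^{1/q}$ if $q>0$, or if $q<0$ and $M$ is positive definite; $\phi_0(M)=\det(M)^{1/p}$ if $M$ is positive definite; and $\phi_q(M)=0$ if $q\le 0$ and $M$ is singular. Consider the problem $$\max\ \phi_q(M_d(\mathbf y))\quad\text{s.t.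 } \mathbf y\in\mathcal M_{2d}(\mathcal X),\ y_0=1.\qquad(\ast)$$ Then $(\ast)$ is a convex optimization problem (its feasible set is convex and its objective is concave on it), and it has a unique optimal solution $\mathbf y^\star$. The matrix $M_d(\mathbf y^\star)$ is positive definite. Whenever $M_d(\mathbf y)$ is positive definite, put $p_{\mathbf y}(x)=\mathbf v_d(x)^\top M_d(\mathbf y)^{q-1}\mathbf v_d(x)$, and let $p_d^\star=p_{\mathbf y^\star}$; then $p_d^\star(x)=\|M_d(\mathbf y^\star)^{(q-1)/2}\mathbf v_d(x)\|_2^2$ for all $x\in\mathbb R^n$. Moreover, $\mathbf y^\star$ is the vector of moments up to order $2d$ of a discrete probability measure $\mu^\star=\sum_{i=1}^{\ell}w_i\delta_{x_i}$ with distinct points $x_i$, weights $w_i>0$, $\binom{n+d}{n}\le \ell\le\binom{n+2d}{n}$, and all $x_i$ in $$\Omega=\{x\in\mathcal X:\ \mathrm{trace}(M_d(\mathbf y^\star)^q)-p_d^\star(x)=0\}.$$ Finally, for every $\mathbf y=(y_\alpha)_{|\alpha|\le 2d}$ the following are equivalent: 1. $\mathbf y$ is the unique optimal solution of $(\ast)$;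 2. $\mathbf y\in\mathcal M_{2d}(\mathcal X)$, $y_0=1$, $M_d(\mathbf y)$ is positive definite, and $\mathrm{trace}(M_d(\mathbf y)^q)-p_{\mathbf y}(x)\ge 0$ for all $x\in\mathcal X$. -/

import Mathlib

open MeasureTheory
open scoped NNReal

noncomputable section

namespace OptimalDesign

/-- The exponents `α ∈ ℕⁿ` of total degree `|α| = α₁ + ⋯ + αₙ` at most `k`. -/
def expo (n k : ℕ) : Finset (Fin n → ℕ) :=
  (Fintype.piFinset fun _ => Finset.range (k + 1)).filter fun α => ∑ i, α i ≤ k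

theorem mem_expo {n k : ℕ} {α : Fin n → ℕ} : α ∈ expo n k ↔ ∑ i, α i ≤ k := by
  simp only [expo, Finset.mem_filter, Fintype.mem_piFinset, Finset.mem_range,
    and_iff_right_iff_imp]
  intro h i
  have := Finset.single_le_sum (f := α) (fun j _ => Nat.zero_le _) (Finset.mem_univ i)
  omega

/-- The exponent `0`. -/
def zeroExpo (n k : ℕ) : expo n k := ⟨0, mem_expo.2 (by simp)⟩

/-- The sum of two exponents of degree at most `d`, as an exponent of degree at most `2 * d`. -/
def addExpo {n d : ℕ} (α β : expo n d) : expo n (2 * d) :=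
  ⟨α.1 + β.1, mem_expo.2 (by
    have hα := mem_expo.1 α.2
    have hβ := mem_expo.1 β.2
    simp only [Pi.add_apply, Finset.sum_add_distrib]
    omega)⟩

/-- The monomial `x ^ α = x₁ ^ α₁ ⋯ xₙ ^ αₙ`. -/
def mono {n : ℕ} (α : Fin n → ℕ) (x : Fin n → ℝ) : ℝ := ∏ i, x i ^ α i

/-- The vector `v_d(x)` of all monomials of degree at most `d`. -/
def monoVec {n : ℕ} (d : ℕ) (x : Fin n → ℝ) : expo n d → ℝ := fun α => mono α.1 x

/-- The closed basic semi-algebraic set `{x ∈ ℝⁿ : g_j(x) ≥ 0 for all j}`. -/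
def semialgSet {n m : ℕ} (g : Fin m → MvPolynomial (Fin n) ℝ) : Set (Fin n → ℝ) :=
  {x | ∀ j, 0 ≤ MvPolynomial.eval x (g j)}

/-- `y = (y_α)_{|α| ≤ k}` is the vector of moments of `μ` up to order `k`. -/
def IsMomentVector {n k : ℕ} (y : expo n k → ℝ) (μ : Measure (Fin n → ℝ)) : Prop :=
  ∀ α : expo n k, y α = ∫ x, mono α.1 x ∂μ

/-- The moment cone of order `k` of a compact set `X`: all truncated sequences that are
represented by a finite Borel measure supported on `X`. Monomials are bounded on compact sets,
so all the integrals converge. -/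
def momentCone {n : ℕ} (k : ℕ) (X : Set (Fin n → ℝ)) : Set (expo n k → ℝ) :=
  {y | ∃ μ : Measure (Fin n → ℝ), IsFiniteMeasure μ ∧ μ Xᶜ = 0 ∧ IsMomentVector y μ}

/-- The moment matrix `M_d(y)`, with entries `M_d(y)(α, β) = y_{α + β}`. -/
def momentMatrix {n d : ℕ} (y : expo n (2 * d) → ℝ) : Matrix (expo n d) (expo n d) ℝ :=
  Matrix.of fun α β => y (addExpo α β)

/-- The real power `M ^ r` of a symmetric matrix, by the spectral calculus
(meant for `M` positive definite, or `M` positive semidefinite and `r > 0`). -/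
def matPow {ι : Type*} [Fintype ι] [DecidableEq ι] (M : Matrix ι ι ℝ) (r : ℝ) : Matrix ι ι ℝ :=
  cfc (fun t : ℝ => t ^ r) M

open Classical in
/-- Kiefer's criterion `φ_q` for real `q`, on positive semidefinite matrices of size `p`:
`((1 / p) trace (M ^ q)) ^ (1 / q)` if `q > 0`, or if `q < 0` and `M` is positive definite;
`det (M) ^ (1 / p)` if `q = 0` and `M` is positive definite;
`0` if `q ≤ 0` and `M` is singular. -/
def phi {ι : Type*} [Fintype ι] [DecidableEq ι] (q : ℝ) (M : Matrix ι ι ℝ) : ℝ :=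
  if 0 < q ∨ (q < 0 ∧ M.PosDef) then
    ((1 / (Fintype.card ι : ℝ)) * (matPow M q).trace) ^ (1 / q)
  else if q = 0 ∧ M.PosDef then M.det ^ (1 / (Fintype.card ι : ℝ))
  else 0

/-- The feasible set of the ideal problem: `y ∈ M_{2d}(X)` with `y₀ = 1`. -/
def feasibleSet {n : ℕ} (d : ℕ) (X : Set (Fin n → ℝ)) : Set (expo n (2 * d) → ℝ) :=
  {y | y ∈ momentCone (2 * d) X ∧ y (zeroExpo n (2 * d)) = 1}

/-- The objective function `y ↦ φ_q(M_d(y))` of the ideal problem. -/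
def objective {n d : ℕ} (q : ℝ) (y : expo n (2 * d) → ℝ) : ℝ := phi q (momentMatrix y)

/-- `y` is an optimal solution of the ideal problem `max φ_q(M_d(y))` over the feasible set. -/
def IsSolution {n d : ℕ} (q : ℝ) (X : Set (Fin n → ℝ)) (y : expo n (2 * d) → ℝ) : Prop :=
  y ∈ feasibleSet d X ∧ ∀ z ∈ feasibleSet d X, objective q z ≤ objective q y

/-- `y` is the unique optimal solution of the ideal problem. -/
def IsUniqueSolution {n d : ℕ} (q : ℝ) (X : Set (Fin n → ℝ)) (y : expo n (2 * d) → ℝ) : Prop :=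
  IsSolution q X y ∧ ∀ z, IsSolution q X z → z = y

/-- The polynomial function `p_d : x ↦ v_d(x)ᵀ M_d(y) ^ (q - 1) v_d(x)`
(meant for `M_d(y)` positive definite). -/
def christoffelPoly {n d : ℕ} (q : ℝ) (y : expo n (2 * d) → ℝ) (x : Fin n → ℝ) : ℝ :=
  monoVec d x ⬝ᵥ (Matrix.mulVec (matPow (momentMatrix y) (q - 1)) (monoVec d x))

/-- The polynomial function `trace (M_d(y) ^ q) - p_d`. -/
def dualPoly {n d : ℕ} (q : ℝ) (y : expo n (2 * d) → ℝ) (x : Fin n → ℝ) : ℝ :=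
  (matPow (momentMatrix y) q).trace - christoffelPoly q y x

/-- The contact set `Ω = {x ∈ X : trace (M_d(y) ^ q) - p_d(x) = 0}`. -/
def contactSet {n d : ℕ} (q : ℝ) (X : Set (Fin n → ℝ)) (y : expo n (2 * d) → ℝ) :
    Set (Fin n → ℝ) :=
  {x | x ∈ X ∧ dualPoly q y x = 0}

/-- The discrete measure `∑_{x ∈ S} w(x) δ_x`. -/
def discreteMeasure {n : ℕ} (S : Finset (Fin n → ℝ)) (w : (Fin n → ℝ) → ℝ≥0) :
    Measure (Fin n → ℝ) :=
  ∑ x ∈ S, w x • Measure.dirac x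

end OptimalDesign

end

/-!
The argument rests on a family of supporting linear functionals of Kiefer's criterion. For `M`
positive definite put `ℓ_M(A) = φ_q(M) · trace (M ^ (q - 1) A) / trace (M ^ q)`. Then
`φ_q(A) ≤ ℓ_M(A)` for every positive semidefinite `A`, with equality for positive definite `A` only
if `A` is a multiple of `M` (`phi_le_support_and_eq`). To see this, expand all traces in eigenbases
of `A` and `M`: with the squared inner products of the eigenvectors as nonnegative weights, each
trace becomes a sum of scalar terms (`sum_overlap_mul`), and the inequality follows termwise from
the tangent line inequality for `t ^ q / q`, or for the logarithm if `q = 0`, at a suitable multiple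
of the eigenvalues of `M`.

Since moreover `φ_q(A + ε) → φ_q(A)` as `ε ↓ 0`, the criterion is the infimum of the functionals
`ℓ_M`, so it is concave and upper semicontinuous on the positive semidefinite cone, singular
matrices included (`concaveOn_phi`, `upperSemicontinuousOn_phi`).

The feasible set is the convex hull of the compact monomial curve `{v_{2d}(x) : x ∈ X}`
(`feasibleSet_eq_convexHull`), hence compact, and an optimal solution exists. Comparing an optimal
`y` with the points of segments from `y` gives the necessary conditions: `M_d(y)` is positive
definite, since at a singular matrix `φ_q` vanishes if `q ≤ 0`, and grows at an infinite rate
towards the positive definite matrices if `0 < q` (`posDef_of_isMax`); and the directional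
derivative towards `v_{2d}(x)` is nonpositive, which says that the dual polynomial is nonnegative at
`x` (`trace_matPow_mul_le_of_isMax`). Conversely, if these conditions hold at `y`, then
`ℓ_{M_d(y)} ≤ φ_q(M_d(y))` on the monomial curve, hence on its convex hull, so `y` is optimal, and
the equality case shows that it is the only solution (`isUniqueSolution_of_dual`).

Carathéodory's theorem represents `y` by at most `binom(n + 2d, n)` atoms, while positive
definiteness of `M_d(y)` forces at least `binom(n + d, n)` of them. The dual polynomial is
nonnegative on the atoms and has mean zero, so it vanishes at each of them.
-/

namespace OptimalDesign

open Filter Topology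

/-! ### Spectral calculus and traces of pairs of symmetric matrices -/

section Spectral

variable {ι : Type*} [Fintype ι] [DecidableEq ι]

/-- Every real function of a symmetric matrix is obtained from the eigenvalues, with no continuity
required, since the spectrum is finite. -/
theorem cfc_eq_conj {A : Matrix ι ι ℝ} (hA : A.IsHermitian) (f : ℝ → ℝ) :
    cfc f A = (hA.eigenvectorUnitary : Matrix ι ι ℝ) *
      Matrix.diagonal (f ∘ hA.eigenvalues) * star (hA.eigenvectorUnitary : Matrix ι ι ℝ) := by
  rw [hA.cfc_eq, Matrix.IsHermitian.cfc, Unitary.conjStarAlgAut_apply]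
  rfl

theorem continuousOn_spectrum (A : Matrix ι ι ℝ) (f : ℝ → ℝ) : ContinuousOn f (spectrum ℝ A) :=
  A.finite_real_spectrum.continuousOn f

theorem trace_cfc {A : Matrix ι ι ℝ} (hA : A.IsHermitian) (f : ℝ → ℝ) :
    (cfc f A).trace = ∑ i, f (hA.eigenvalues i) := by
  rw [cfc_eq_conj hA, Matrix.trace_mul_cycle, Unitary.coe_star_mul_self, one_mul,
    Matrix.trace_diagonal]
  rfl

theorem det_cfc {A : Matrix ι ι ℝ} (hA : A.IsHermitian) (f : ℝ → ℝ) :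
    (cfc f A).det = ∏ i, f (hA.eigenvalues i) := by
  rw [cfc_eq_conj hA, Matrix.det_mul_right_comm,
    Unitary.mul_star_self_of_mem hA.eigenvectorUnitary.2, one_mul, Matrix.det_diagonal]
  rfl

/-- The squared inner products `⟨w_j, u_i⟩²` between the eigenvectors `w_j` of `M` and the
eigenvectors `u_i` of `A`. -/
noncomputable def overlap {A M : Matrix ι ι ℝ} (hM : M.IsHermitian) (hA : A.IsHermitian)
    (j i : ι) : ℝ :=
  ((star (hM.eigenvectorUnitary : Matrix ι ι ℝ) * (hA.eigenvectorUnitary : Matrix ι ι ℝ)) j i) ^ 2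

theorem overlap_nonneg {A M : Matrix ι ι ℝ} (hM : M.IsHermitian) (hA : A.IsHermitian) (j i : ι) :
    0 ≤ overlap hM hA j i := sq_nonneg _

theorem trace_cfc_mul_cfc {A M : Matrix ι ι ℝ} (hM : M.IsHermitian) (hA : A.IsHermitian)
    (h f : ℝ → ℝ) :
    (cfc h M * cfc f A).trace =
      ∑ j, ∑ i, overlap hM hA j i * (h (hM.eigenvalues j) * f (hA.eigenvalues i)) := by
  rw [cfc_eq_conj hA, cfc_eq_conj hM]
  set U := (hA.eigenvectorUnitary : Matrix ι ι ℝ)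
  set W := (hM.eigenvectorUnitary : Matrix ι ι ℝ)
  set K : Matrix ι ι ℝ := star W * U with hK
  have hKs : star U * W = star K := by rw [hK, star_mul, star_star]
  have : (W * Matrix.diagonal (h ∘ hM.eigenvalues) * star W *
      (U * Matrix.diagonal (f ∘ hA.eigenvalues) * star U)).trace =
      (Matrix.diagonal (h ∘ hM.eigenvalues) * K *
        (Matrix.diagonal (f ∘ hA.eigenvalues) * star K)).trace := by
    rw [← hKs, hK]
    simp only [Matrix.mul_assoc]
    rw [Matrix.trace_mul_comm]
    simp only [Matrix.mul_assoc]
  rw [this, Matrix.trace]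
  refine Finset.sum_congr rfl fun j _ => ?_
  rw [Matrix.diag_apply, Matrix.mul_apply]
  refine Finset.sum_congr rfl fun i _ => ?_
  rw [Matrix.diagonal_mul, Matrix.diagonal_mul, Matrix.star_apply, overlap]
  simp only [Function.comp_apply, star_trivial]
  ring

/-- Traces of functions of `A` and of `M`, and of products of a function of `M` with `A`, are
weighted sums of scalar expressions in the eigenvalues. This reduces trace inequalities to scalar
ones. -/
theorem sum_overlap_mul {A M : Matrix ι ι ℝ} (hM : M.IsHermitian) (hA : A.IsHermitian)
    (f g h : ℝ → ℝ) :
    ∑ j, ∑ i, overlap hM hA j i * (f (hA.eigenvalues i) + g (hM.eigenvalues j) +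
        h (hM.eigenvalues j) * hA.eigenvalues i) =
      (cfc f A).trace + (cfc g M).trace + (cfc h M * A).trace := by
  have h1 := trace_cfc_mul_cfc hM hA (fun _ => 1) f
  have h2 := trace_cfc_mul_cfc hM hA g (fun _ => 1)
  have h3 := trace_cfc_mul_cfc hM hA h id
  rw [cfc_const_one ℝ M hM.isSelfAdjoint, one_mul] at h1
  rw [cfc_const_one ℝ A hA.isSelfAdjoint, mul_one] at h2
  rw [cfc_id ℝ A hA.isSelfAdjoint] at h3
  rw [h1, h2, h3, ← Finset.sum_add_distrib, ← Finset.sum_add_distrib]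
  refine Finset.sum_congr rfl fun j _ => ?_
  rw [← Finset.sum_add_distrib, ← Finset.sum_add_distrib]
  refine Finset.sum_congr rfl fun i _ => ?_
  simp only [id]
  ring

/-- Klein's inequality: a scalar inequality between the eigenvalues of two symmetric matrices,
linear in the eigenvalues of `A` up to a separate term, carries over to traces. -/
theorem trace_cfc_add_nonneg {A M : Matrix ι ι ℝ} (hM : M.IsHermitian) (hA : A.IsHermitian)
    {f g h : ℝ → ℝ} (H : ∀ j i, 0 ≤ f (hA.eigenvalues i) + g (hM.eigenvalues j) +
        h (hM.eigenvalues j) * hA.eigenvalues i) :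
    0 ≤ (cfc f A).trace + (cfc g M).trace + (cfc h M * A).trace := by
  rw [← sum_overlap_mul hM hA]
  exact Finset.sum_nonneg fun j _ => Finset.sum_nonneg fun i _ =>
    mul_nonneg (overlap_nonneg hM hA j i) (H j i)

/-- The weighted sum of the squares `(a_i - s m_j) ^ 2` is the squared Frobenius norm of
`A - s • M`, so that matching eigenvalues on the support of the weights determines `A`. -/
theorem eq_smul_of_overlap {A M : Matrix ι ι ℝ} (hM : M.IsHermitian) (hA : A.IsHermitian) (s : ℝ)
    (H : ∀ j i, overlap hM hA j i ≠ 0 → hA.eigenvalues i = s * hM.eigenvalues j) :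
    A = s • M := by
  have h0 := sum_overlap_mul hM hA (fun a => a * a) (fun m => (s * m) * (s * m))
    (fun m => (-(2 * s)) * m)
  have h1 : ∑ j, ∑ i, overlap hM hA j i * (hA.eigenvalues i * hA.eigenvalues i +
      (s * hM.eigenvalues j) * (s * hM.eigenvalues j) +
        (-(2 * s)) * hM.eigenvalues j * hA.eigenvalues i) = 0 := by
    refine Finset.sum_eq_zero fun j _ => Finset.sum_eq_zero fun i _ => ?_
    by_cases hji : overlap hM hA j i = 0
    · rw [hji, zero_mul]
    · rw [H j i hji]; ring
  rw [h1] at h0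
  have eA : cfc (fun a : ℝ => a * a) A = A * A := by
    rw [cfc_mul (fun a : ℝ => a) (fun a : ℝ => a) A, cfc_id' ℝ A hA.isSelfAdjoint]
  have eM : cfc (fun m : ℝ => s * m) M = s • M := cfc_const_mul_id s M hM.isSelfAdjoint
  have eM2 : cfc (fun m : ℝ => (s * m) * (s * m)) M = (s • M) * (s • M) := by
    rw [cfc_mul (fun a : ℝ => s * a) (fun a : ℝ => s * a) M, eM]
  have eM3 : cfc (fun m : ℝ => (-(2 * s)) * m) M = (-(2 * s)) • M :=
    cfc_const_mul_id _ M hM.isSelfAdjoint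
  rw [eA, eM2, eM3] at h0
  have hh : (A - s • M).conjTranspose = A - s • M := by
    rw [Matrix.conjTranspose_sub, Matrix.conjTranspose_smul, hA.eq, hM.eq, star_trivial]
  have h2 : ((A - s • M).conjTranspose * (A - s • M)).trace = 0 := by
    rw [hh, h0]
    simp only [Matrix.sub_mul, Matrix.mul_sub, Matrix.trace_sub, Matrix.smul_mul, Matrix.mul_smul,
      Matrix.trace_smul, smul_eq_mul]
    rw [Matrix.trace_mul_comm A M]
    ring
  exact sub_eq_zero.1 (Matrix.trace_conjTranspose_mul_self_eq_zero_iff.1 h2)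

/-- The equality case of Klein's inequality. -/
theorem eq_smul_of_trace_eq_zero {A M : Matrix ι ι ℝ} (hM : M.IsHermitian) (hA : A.IsHermitian)
    {f g h : ℝ → ℝ} (s : ℝ)
    (H : ∀ j i, 0 ≤ f (hA.eigenvalues i) + g (hM.eigenvalues j) +
        h (hM.eigenvalues j) * hA.eigenvalues i)
    (H' : ∀ j i, f (hA.eigenvalues i) + g (hM.eigenvalues j) +
        h (hM.eigenvalues j) * hA.eigenvalues i = 0 → hA.eigenvalues i = s * hM.eigenvalues j)
    (h0 : (cfc f A).trace + (cfc g M).trace + (cfc h M * A).trace = 0) :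
    A = s • M := by
  refine eq_smul_of_overlap hM hA s fun j i hji => H' j i ?_
  rw [← sum_overlap_mul hM hA] at h0
  have hn : ∀ j i, 0 ≤ overlap hM hA j i * (f (hA.eigenvalues i) + g (hM.eigenvalues j) +
        h (hM.eigenvalues j) * hA.eigenvalues i) := fun j i =>
    mul_nonneg (overlap_nonneg hM hA j i) (H j i)
  have h1 := (Finset.sum_eq_zero_iff_of_nonneg fun j _ => Finset.sum_nonneg fun i _ => hn j i).1 h0
    j (Finset.mem_univ j)
  have h2 := (Finset.sum_eq_zero_iff_of_nonneg fun i _ => hn j i).1 h1 i (Finset.mem_univ i)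
  exact (mul_eq_zero.1 h2).resolve_left hji

theorem trace_matPow {A : Matrix ι ι ℝ} (hA : A.IsHermitian) (r : ℝ) :
    (matPow A r).trace = ∑ i, hA.eigenvalues i ^ r := trace_cfc hA _

theorem trace_matPow_pos [Nonempty ι] {M : Matrix ι ι ℝ} (hM : M.PosDef) (r : ℝ) :
    0 < (matPow M r).trace := by
  rw [trace_matPow hM.1]
  exact Finset.sum_pos (fun i _ => Real.rpow_pos_of_pos (hM.eigenvalues_pos i) r)
    Finset.univ_nonempty

theorem matPow_mul {M : Matrix ι ι ℝ} (hM : M.PosDef) (r t : ℝ) :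
    matPow M r * matPow M t = matPow M (r + t) := by
  rw [matPow, matPow, matPow, ← cfc_mul _ _ M (continuousOn_spectrum M _)
    (continuousOn_spectrum M _)]
  refine cfc_congr fun x hx => ?_
  rw [hM.1.spectrum_real_eq_range_eigenvalues] at hx
  obtain ⟨i, rfl⟩ := hx
  exact (Real.rpow_add (hM.eigenvalues_pos i) r t).symm

theorem matPow_one {M : Matrix ι ι ℝ} (hM : M.IsHermitian) : matPow M 1 = M := by
  simp only [matPow, Real.rpow_one]
  exact cfc_id' ℝ M hM.isSelfAdjoint

theorem matPow_isHermitian (M : Matrix ι ι ℝ) (r : ℝ) : (matPow M r).IsHermitian :=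
  (cfc_predicate (fun t : ℝ => t ^ r) M : IsSelfAdjoint _)

open scoped Matrix.Norms.L2Operator in
/-- Continuity of the spectral calculus, from its isometric form for the operator norm, which
induces the entrywise topology of matrices. -/
theorem continuousOn_matPow (r : ℝ) :
    ContinuousOn (fun M : Matrix ι ι ℝ => matPow M r) {M | M.PosDef} := by
  refine ContinuousOn.cfc_of_mem_nhdsSet (s := Set.Ioi 0) (fun t : ℝ => t ^ r) ?_ continuousOn_id
    (fun M hM => hM.1.isSelfAdjoint) ?_
  · refine isOpen_Ioi.mem_nhdsSet.2 ?_
    refine Set.iUnion₂_subset fun M hM => ?_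
    have hM : M.PosDef := hM
    change spectrum ℝ M ⊆ _
    rw [hM.1.spectrum_real_eq_range_eigenvalues]
    rintro _ ⟨i, rfl⟩
    exact hM.eigenvalues_pos i
  · exact fun x hx => (Real.continuousAt_rpow_const x r (Or.inl (ne_of_gt hx))).continuousWithinAt

/-! ### Scalar tangent inequalities -/

/-- Bernoulli's inequality in the form `(x ^ q - 1) / q ≤ x - 1`, valid for both signs of `q`, with
its equality case. -/
theorem bernoulli_deficit {q x : ℝ} (hq0 : q ≠ 0) (hq1 : q < 1) (hx : 0 ≤ x) (hqx : 0 < q ∨ 0 < x) :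
    0 ≤ q⁻¹ * (1 + q * (x - 1) - x ^ q) ∧ (q⁻¹ * (1 + q * (x - 1) - x ^ q) = 0 → x = 1) := by
  by_cases hx1 : x = 1
  · subst hx1; simp
  have hpos : 0 < q⁻¹ * (1 + q * (x - 1) - x ^ q) := by
    rcases lt_or_gt_of_ne hq0 with hq | hq
    · have hx0 : 0 < x := hqx.resolve_left (not_lt.2 hq.le)
      have h1 : Real.log x < x - 1 := Real.log_lt_sub_one_of_pos hx0 hx1
      have h2 : q * Real.log x + 1 ≤ x ^ q := by
        rw [Real.rpow_def_of_pos hx0, mul_comm]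
        exact Real.add_one_le_exp _
      exact mul_pos_of_neg_of_neg (inv_lt_zero.2 hq) (by nlinarith)
    · have h1 := rpow_one_add_lt_one_add_mul_self (s := x - 1) (by linarith)
        (sub_ne_zero.2 hx1) hq hq1
      rw [add_sub_cancel] at h1
      exact mul_pos (inv_pos.2 hq) (by linarith)
  exact ⟨hpos.le, fun h => absurd h hpos.ne'⟩

/-- The tangent line of `t ↦ t ^ q / q` at `b` lies above the graph and touches it only at `b`. -/
theorem tangent_deficit {q a b : ℝ} (hq0 : q ≠ 0) (hq1 : q < 1) (ha : 0 ≤ a) (hb : 0 < b)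
    (hqa : 0 < q ∨ 0 < a) :
    0 ≤ -q⁻¹ * a ^ q + q⁻¹ * (1 - q) * b ^ q + b ^ (q - 1) * a ∧
      (-q⁻¹ * a ^ q + q⁻¹ * (1 - q) * b ^ q + b ^ (q - 1) * a = 0 → a = b) := by
  obtain ⟨h1, h2⟩ := bernoulli_deficit (x := a / b) hq0 hq1 (by positivity)
    (hqa.imp_right fun h => by positivity)
  have hbq : 0 < b ^ q := Real.rpow_pos_of_pos hb q
  have e : -q⁻¹ * a ^ q + q⁻¹ * (1 - q) * b ^ q + b ^ (q - 1) * a =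
      b ^ q * (q⁻¹ * (1 + q * (a / b - 1) - (a / b) ^ q)) := by
    rw [Real.div_rpow ha hb.le, Real.rpow_sub_one hb.ne']
    field_simp
    ring
  rw [e]
  refine ⟨by positivity, fun h => ?_⟩
  have := h2 ((mul_eq_zero.1 h).resolve_left hbq.ne')
  rwa [div_eq_one_iff_eq hb.ne'] at this

/-- The tangent line of the logarithm at `b` lies above the graph and touches it only at `b`. -/
theorem log_tangent_deficit {a b : ℝ} (ha : 0 < a) (hb : 0 < b) :
    0 ≤ -Real.log a + (Real.log b - 1) + b⁻¹ * a ∧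
      (-Real.log a + (Real.log b - 1) + b⁻¹ * a = 0 → a = b) := by
  have e : -Real.log a + (Real.log b - 1) + b⁻¹ * a = a / b - 1 - Real.log (a / b) := by
    rw [Real.log_div ha.ne' hb.ne']; field_simp; ring
  rw [e]
  refine ⟨by linarith [Real.log_le_sub_one_of_pos (div_pos ha hb)], fun h => ?_⟩
  by_contra hab
  have := Real.log_lt_sub_one_of_pos (div_pos ha hb) (by rwa [Ne, div_eq_one_iff_eq hb.ne'])
  linarith

theorem trace_cfc_const_mul (c : ℝ) (f : ℝ → ℝ) (A : Matrix ι ι ℝ) :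
    (cfc (fun t => c * f t) A).trace = c * (cfc f A).trace := by
  rw [cfc_const_mul c f A (continuousOn_spectrum A f), Matrix.trace_smul, smul_eq_mul]

/-! ### Kiefer's criterion and its supporting functionals -/

theorem phi_of_ne_zero {q : ℝ} (hq : q ≠ 0) {A : Matrix ι ι ℝ} (h : 0 < q ∨ A.PosDef) :
    phi q A = ((1 / (Fintype.card ι : ℝ)) * (matPow A q).trace) ^ (1 / q) := by
  rw [phi, if_pos]
  rcases lt_or_gt_of_ne hq with hq | hq
  · exact Or.inr ⟨hq, h.resolve_left (not_lt.2 hq.le)⟩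
  · exact Or.inl hq

theorem posDef_iff_det_pos {A : Matrix ι ι ℝ} (hA : A.PosSemidef) : A.PosDef ↔ 0 < A.det := by
  refine ⟨fun h => h.det_pos, fun h => ?_⟩
  rw [hA.1.posDef_iff_eigenvalues_pos]
  rw [hA.1.det_eq_prod_eigenvalues] at h
  intro i
  refine lt_of_le_of_ne (hA.eigenvalues_nonneg i) fun h0 => h.ne' ?_
  exact Finset.prod_eq_zero (Finset.mem_univ i) (by rw [← h0]; rfl)

theorem phi_zero [Nonempty ι] {A : Matrix ι ι ℝ} (hA : A.PosSemidef) :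
    phi 0 A = A.det ^ (1 / (Fintype.card ι : ℝ)) := by
  by_cases h : A.PosDef
  · simp [phi, h]
  · have : A.det = 0 := by
      rw [posDef_iff_det_pos hA, not_lt] at h
      exact le_antisymm h hA.det_nonneg
    rw [this, Real.zero_rpow (by positivity)]
    simp [phi, h]

theorem phi_of_not_posDef {q : ℝ} (hq : q ≤ 0) {A : Matrix ι ι ℝ} (hA : ¬ A.PosDef) :
    phi q A = 0 := by
  simp [phi, hA, not_lt.2 hq]

theorem phi_pos [Nonempty ι] (q : ℝ) {M : Matrix ι ι ℝ} (hM : M.PosDef) : 0 < phi q M := by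
  by_cases hq : q = 0
  · subst hq
    rw [phi_zero hM.posSemidef]
    exact Real.rpow_pos_of_pos hM.det_pos _
  · rw [phi_of_ne_zero hq (Or.inr hM)]
    have := trace_matPow_pos hM q
    positivity

/-- The linear functional `A ↦ φ_q(M) · trace (M ^ (q - 1) A) / trace (M ^ q)`, which supports
`φ_q` at `M`. -/
noncomputable def supportFunctional (q : ℝ) (M A : Matrix ι ι ℝ) : ℝ :=
  phi q M * ((matPow M (q - 1) * A).trace / (matPow M q).trace)

theorem trace_matPow_mul_self {M : Matrix ι ι ℝ} (hM : M.PosDef) (q : ℝ) :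
    (matPow M (q - 1) * M).trace = (matPow M q).trace := by
  have := matPow_mul hM (q - 1) 1
  rw [matPow_one hM.1, sub_add_cancel] at this
  rw [this]

theorem trace_matPow_mul_eq {A M : Matrix ι ι ℝ} (hM : M.IsHermitian) (hA : A.IsHermitian)
    (r : ℝ) : (matPow M r * A).trace =
      ∑ j, ∑ i, overlap hM hA j i * (hM.eigenvalues j ^ r * hA.eigenvalues i) := by
  have := trace_cfc_mul_cfc hM hA (fun t => t ^ r) id
  rwa [cfc_id ℝ A hA.isSelfAdjoint] at this

theorem trace_matPow_mul_nonneg {A M : Matrix ι ι ℝ} (hM : M.PosDef) (hA : A.PosSemidef)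
    (r : ℝ) : 0 ≤ (matPow M r * A).trace := by
  rw [trace_matPow_mul_eq hM.1 hA.1]
  exact Finset.sum_nonneg fun j _ => Finset.sum_nonneg fun i _ =>
    mul_nonneg (overlap_nonneg _ _ _ _)
      (mul_nonneg (Real.rpow_nonneg (hM.eigenvalues_pos j).le r) (hA.eigenvalues_nonneg i))

theorem eq_zero_of_trace_matPow_mul {A M : Matrix ι ι ℝ} (hM : M.PosDef) (hA : A.PosSemidef)
    {r : ℝ} (h : (matPow M r * A).trace = 0) : A = 0 := by
  have hz : ∀ (N : Matrix ι ι ℝ), (cfc (fun _ : ℝ => (0 : ℝ)) N).trace = 0 := fun N => by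
    rw [cfc_const_zero, Matrix.trace_zero]
  rw [← zero_smul ℝ M]
  refine eq_smul_of_trace_eq_zero hM.1 hA.1 (f := fun _ => 0) (g := fun _ => 0)
    (h := fun t => t ^ r) 0 (fun j i => ?_) (fun j i h => ?_) ?_
  · have := Real.rpow_nonneg (hM.eigenvalues_pos j).le r
    have := hA.eigenvalues_nonneg i
    positivity
  · have := Real.rpow_pos_of_pos (hM.eigenvalues_pos j) r
    rw [zero_add, zero_add, mul_eq_zero] at h
    rw [h.resolve_left this.ne', zero_mul]
  · rw [hz, hz, zero_add, zero_add]
    exact h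

section Support

variable [Nonempty ι]

theorem support_self {M : Matrix ι ι ℝ} (hM : M.PosDef) (q : ℝ) :
    supportFunctional q M M = phi q M := by
  rw [supportFunctional, trace_matPow_mul_self hM, div_self (trace_matPow_pos hM q).ne', mul_one]

/-- Hölder's inequality away from `q = 0`, from the tangent lines of `t ^ q / q` at the points
`s * m`, with `m` an eigenvalue of `M`. The scaling `s` is the one that makes the bound sharpest. -/
theorem phi_le_support_of_ne_zero {q : ℝ} (hq0 : q ≠ 0) (hq1 : q < 1) {A M : Matrix ι ι ℝ}
    (hM : M.PosDef) (hA : A.PosSemidef) (hqA : 0 < q ∨ A.PosDef) {s : ℝ} (hs : 0 < s)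
    (hsU : (matPow M (q - 1) * A).trace = s * (matPow M q).trace) :
    phi q A ≤ phi q M * s ∧ (phi q A = phi q M * s → A = s • M) := by
  have hT := trace_matPow_pos hM q
  have hp : (0 : ℝ) < Fintype.card ι := by exact_mod_cast Fintype.card_pos
  have hm := hM.eigenvalues_pos
  have key : ∀ j i, _ := fun j i => tangent_deficit (a := hA.1.eigenvalues i)
    (b := s * hM.1.eigenvalues j) hq0 hq1 (hA.eigenvalues_nonneg i) (mul_pos hs (hm j))
    (hqA.imp_right fun h => h.eigenvalues_pos i)
  have e : ∀ j i, -q⁻¹ * hA.1.eigenvalues i ^ q + q⁻¹ * (1 - q) * (s * hM.1.eigenvalues j) ^ q +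
      (s * hM.1.eigenvalues j) ^ (q - 1) * hA.1.eigenvalues i =
      -q⁻¹ * hA.1.eigenvalues i ^ q + (q⁻¹ * (1 - q) * s ^ q) * hM.1.eigenvalues j ^ q +
      (s ^ (q - 1) * hM.1.eigenvalues j ^ (q - 1)) * hA.1.eigenvalues i := fun j i => by
    rw [Real.mul_rpow hs.le (hm j).le, Real.mul_rpow hs.le (hm j).le]; ring
  simp only [e] at key
  have hsum : (cfc (fun a : ℝ => -q⁻¹ * a ^ q) A).trace +
      (cfc (fun m : ℝ => (q⁻¹ * (1 - q) * s ^ q) * m ^ q) M).trace +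
      (cfc (fun m : ℝ => s ^ (q - 1) * m ^ (q - 1)) M * A).trace =
      q⁻¹ * (s ^ q * (matPow M q).trace - (matPow A q).trace) := by
    rw [trace_cfc_const_mul, trace_cfc_const_mul, cfc_const_mul _ _ M (continuousOn_spectrum M _),
      Matrix.smul_mul, Matrix.trace_smul, smul_eq_mul]
    change -q⁻¹ * (matPow A q).trace + _ * (matPow M q).trace +
      _ * (matPow M (q - 1) * A).trace = _
    rw [hsU, Real.rpow_sub_one hs.ne']
    field_simp
    ring
  have hnn := trace_cfc_add_nonneg hM.1 hA.1 (f := fun a : ℝ => -q⁻¹ * a ^ q)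
    (g := fun m : ℝ => (q⁻¹ * (1 - q) * s ^ q) * m ^ q)
    (h := fun m : ℝ => s ^ (q - 1) * m ^ (q - 1)) fun j i => (key j i).1
  rw [hsum] at hnn
  have hA0 : 0 ≤ (matPow A q).trace := by
    rw [trace_matPow hA.1]
    exact Finset.sum_nonneg fun i _ => Real.rpow_nonneg (hA.eigenvalues_nonneg i) q
  have hsT : 0 < s ^ q * (matPow M q).trace := mul_pos (Real.rpow_pos_of_pos hs q) hT
  have eM : phi q M * s =
      ((1 / (Fintype.card ι : ℝ)) * (s ^ q * (matPow M q).trace)) ^ (1 / q) := by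
    rw [phi_of_ne_zero hq0 (Or.inr hM), mul_left_comm, mul_comm (s ^ q),
      Real.mul_rpow (y := s ^ q) (by positivity) (by positivity), ← Real.rpow_mul hs.le,
      mul_one_div_cancel hq0, Real.rpow_one]
  rw [eM, phi_of_ne_zero hq0 hqA]
  constructor
  · rcases lt_or_gt_of_ne hq0 with hq | hq
    · refine Real.rpow_le_rpow_of_nonpos (by positivity) ?_ (one_div_neg.2 hq).le
      gcongr
      by_contra! hlt
      exact absurd hnn (not_le.2 (mul_neg_of_neg_of_pos (inv_lt_zero.2 hq) (by linarith)))
    · refine Real.rpow_le_rpow (by positivity) ?_ (one_div_pos.2 hq).le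
      gcongr
      by_contra! hlt
      exact absurd hnn (not_le.2 (mul_neg_of_pos_of_neg (inv_pos.2 hq) (by linarith)))
  · intro h
    have h1 := Real.rpow_left_injOn (one_div_ne_zero hq0) (Set.mem_ofPred.2 (by positivity))
      (Set.mem_ofPred.2 (by positivity)) h
    have h2 := mul_left_cancel₀ (one_div_ne_zero hp.ne') h1
    refine eq_smul_of_trace_eq_zero hM.1 hA.1 (f := fun a : ℝ => -q⁻¹ * a ^ q)
      (g := fun m : ℝ => (q⁻¹ * (1 - q) * s ^ q) * m ^ q)
      (h := fun m : ℝ => s ^ (q - 1) * m ^ (q - 1)) s (fun j i => (key j i).1)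
      (fun j i => (key j i).2) ?_
    rw [hsum, h2, sub_self, mul_zero]

theorem phi_zero_eq_exp {M : Matrix ι ι ℝ} (hM : M.PosDef) :
    phi 0 M = Real.exp ((cfc Real.log M).trace / Fintype.card ι) := by
  rw [phi_zero hM.posSemidef, trace_cfc hM.1, hM.1.det_eq_prod_eigenvalues,
    ← Real.log_prod fun i _ => (hM.eigenvalues_pos i).ne', Real.rpow_def_of_pos, mul_one_div]
  · rfl
  · exact Finset.prod_pos fun i _ => hM.eigenvalues_pos i

/-- Hölder's inequality for the determinant, from the tangent lines of the logarithm at the points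
`s * m`, with `m` an eigenvalue of `M`. -/
theorem phi_le_support_of_eq_zero {A M : Matrix ι ι ℝ}
    (hM : M.PosDef) (hA : A.PosDef) {s : ℝ} (hs : 0 < s)
    (hsU : (matPow M ((0 : ℝ) - 1) * A).trace = s * (matPow M 0).trace) :
    phi 0 A ≤ phi 0 M * s ∧ (phi 0 A = phi 0 M * s → A = s • M) := by
  have hp : (0 : ℝ) < Fintype.card ι := by exact_mod_cast Fintype.card_pos
  have hm := hM.eigenvalues_pos
  have key : ∀ j i, _ := fun j i => log_tangent_deficit (a := hA.1.eigenvalues i)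
    (b := s * hM.1.eigenvalues j) (hA.eigenvalues_pos i) (mul_pos hs (hm j))
  have e : ∀ j i, -Real.log (hA.1.eigenvalues i) + (Real.log (s * hM.1.eigenvalues j) - 1) +
      (s * hM.1.eigenvalues j)⁻¹ * hA.1.eigenvalues i =
      -1 * Real.log (hA.1.eigenvalues i) + (Real.log s - 1 + Real.log (hM.1.eigenvalues j)) +
      (s⁻¹ * hM.1.eigenvalues j ^ ((0 : ℝ) - 1)) * hA.1.eigenvalues i := fun j i => by
    rw [Real.log_mul hs.ne' (hm j).ne', mul_inv, zero_sub, Real.rpow_neg_one]; ring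
  simp only [e] at key
  have hT : (matPow M 0).trace = Fintype.card ι := by
    rw [trace_matPow hM.1]; simp
  have hsum : (cfc (fun a : ℝ => -1 * Real.log a) A).trace +
      (cfc (fun m : ℝ => Real.log s - 1 + Real.log m) M).trace +
      (cfc (fun m : ℝ => s⁻¹ * m ^ ((0 : ℝ) - 1)) M * A).trace =
      (cfc Real.log M).trace + Fintype.card ι * Real.log s - (cfc Real.log A).trace := by
    rw [trace_cfc_const_mul, trace_cfc hM.1 (fun m : ℝ => Real.log s - 1 + Real.log m),
      Finset.sum_add_distrib, ← trace_cfc hM.1 Real.log,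
      cfc_const_mul _ _ M (continuousOn_spectrum M _),
      Matrix.smul_mul, Matrix.trace_smul, smul_eq_mul]
    change _ + _ + _ * (matPow M ((0 : ℝ) - 1) * A).trace = _
    rw [hsU, hT, Finset.sum_const, Finset.card_univ, nsmul_eq_mul]
    field_simp
    ring
  have hnn := trace_cfc_add_nonneg hM.1 hA.1 (f := fun a : ℝ => -1 * Real.log a)
    (g := fun m : ℝ => Real.log s - 1 + Real.log m)
    (h := fun m : ℝ => s⁻¹ * m ^ ((0 : ℝ) - 1)) fun j i => (key j i).1
  rw [hsum] at hnn
  have eM : phi 0 M * s =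
      Real.exp (((cfc Real.log M).trace + Fintype.card ι * Real.log s) / Fintype.card ι) := by
    rw [phi_zero_eq_exp hM, add_div, mul_div_cancel_left₀ _ hp.ne', Real.exp_add, Real.exp_log hs]
  rw [eM, phi_zero_eq_exp hA]
  constructor
  · rw [Real.exp_le_exp]
    gcongr
    linarith
  · intro h
    have h1 := Real.exp_injective h
    rw [div_left_inj' hp.ne'] at h1
    refine eq_smul_of_trace_eq_zero hM.1 hA.1 (f := fun a : ℝ => -1 * Real.log a)
      (g := fun m : ℝ => Real.log s - 1 + Real.log m)
      (h := fun m : ℝ => s⁻¹ * m ^ ((0 : ℝ) - 1)) s (fun j i => (key j i).1)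
      (fun j i => (key j i).2) ?_
    rw [hsum, h1, sub_self]

/-- Hölder's inequality for `φ_q`: it lies below its supporting functional at `M`, and a positive
definite matrix at which equality holds is a multiple of `M`. -/
theorem phi_le_support_and_eq {q : ℝ} (hq1 : q < 1) {A M : Matrix ι ι ℝ} (hM : M.PosDef)
    (hA : A.PosSemidef) : phi q A ≤ supportFunctional q M A ∧
      (A.PosDef → phi q A = supportFunctional q M A → A =
        ((matPow M (q - 1) * A).trace / (matPow M q).trace) • M) := by
  have hT := trace_matPow_pos hM q
  have hU := trace_matPow_mul_nonneg hM hA (q - 1)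
  have hM0 := phi_pos q hM
  by_cases hqA : 0 < q ∨ A.PosDef
  · rcases hU.eq_or_lt with hU | hU
    · have hA0 := eq_zero_of_trace_matPow_mul hM hA hU.symm
      have hnp : ¬ A.PosDef := fun h => by
        have := h.diag_pos (i := Classical.arbitrary ι)
        simp [hA0] at this
      have hq := hqA.resolve_right hnp
      refine ⟨?_, fun h => absurd h hnp⟩
      rw [supportFunctional, ← hU, phi_of_ne_zero hq.ne' hqA, trace_matPow hA.1]
      have : hA.1.eigenvalues = 0 := hA.1.eigenvalues_eq_zero_iff.2 hA0
      simp [this, Real.zero_rpow hq.ne', Real.zero_rpow (inv_ne_zero hq.ne')]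
    · have hs : 0 < (matPow M (q - 1) * A).trace / (matPow M q).trace := div_pos hU hT
      have hsU := (div_mul_cancel₀ (matPow M (q - 1) * A).trace hT.ne').symm
      rw [supportFunctional]
      by_cases hq0 : q = 0
      · subst hq0
        have hA' := hqA.resolve_left (lt_irrefl _)
        have := phi_le_support_of_eq_zero hM hA' hs hsU
        exact ⟨this.1, fun _ => this.2⟩
      · have := phi_le_support_of_ne_zero hq0 hq1 hM hA hqA hs hsU
        exact ⟨this.1, fun _ => this.2⟩
  · push Not at hqA
    refine ⟨?_, fun h => absurd h hqA.2⟩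
    rw [phi_of_not_posDef hqA.1 hqA.2, supportFunctional]
    positivity

end Support

/-! ### Approximation by positive definite matrices, concavity and semicontinuity -/

theorem add_smul_one_eq_cfc {A : Matrix ι ι ℝ} (hA : A.IsHermitian) (ε : ℝ) :
    A + ε • (1 : Matrix ι ι ℝ) = cfc (fun t : ℝ => t + ε) A := by
  rw [cfc_add_const ε (fun t => t) A (continuousOn_spectrum A _) hA.isSelfAdjoint,
    cfc_id' ℝ A hA.isSelfAdjoint, Algebra.algebraMap_eq_smul_one]

theorem posDef_add_smul_one {κ : Type*} [DecidableEq κ] {A : Matrix κ κ ℝ} (hA : A.PosSemidef)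
    {ε : ℝ} (hε : 0 < ε) : (A + ε • (1 : Matrix κ κ ℝ)).PosDef :=
  Matrix.PosDef.posSemidef_add hA (Matrix.PosDef.one.smul hε)

theorem trace_matPow_add_smul_one {A : Matrix ι ι ℝ} (hA : A.IsHermitian) (ε r : ℝ) :
    (matPow (A + ε • (1 : Matrix ι ι ℝ)) r).trace = ∑ i, (hA.eigenvalues i + ε) ^ r := by
  rw [add_smul_one_eq_cfc hA, matPow, ← cfc_comp' (fun t : ℝ => t ^ r) (fun t : ℝ => t + ε) A
    (((A.finite_real_spectrum).image _).continuousOn _) (continuousOn_spectrum A _)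
    hA.isSelfAdjoint, trace_cfc hA]

/-- The criterion is continuous along `A + ε`, also at singular `A`. This makes it the infimum of
its supporting functionals at positive definite matrices. -/
theorem tendsto_phi_add_smul_one [Nonempty ι] (q : ℝ) {A : Matrix ι ι ℝ} (hA : A.PosSemidef) :
    Tendsto (fun ε : ℝ => phi q (A + ε • (1 : Matrix ι ι ℝ))) (𝓝[>] 0) (𝓝 (phi q A)) := by
  have hp : (0 : ℝ) < Fintype.card ι := by exact_mod_cast Fintype.card_pos
  have hshift : ∀ a : ℝ, Tendsto (fun ε : ℝ => a + ε) (𝓝[>] 0) (𝓝 a) := fun a => by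
    have : Tendsto (fun ε : ℝ => a + ε) (𝓝 0) (𝓝 (a + 0)) := tendsto_const_nhds.add tendsto_id
    rw [add_zero] at this
    exact this.mono_left nhdsWithin_le_nhds
  by_cases hq0 : q = 0
  · subst hq0
    have h1 : (fun ε : ℝ => phi 0 (A + ε • (1 : Matrix ι ι ℝ))) =ᶠ[𝓝[>] 0]
        fun ε => (∏ i, (hA.1.eigenvalues i + ε)) ^ (1 / (Fintype.card ι : ℝ)) := by
      filter_upwards [self_mem_nhdsWithin] with ε hε
      rw [phi_zero (posDef_add_smul_one hA hε).posSemidef, add_smul_one_eq_cfc hA.1, det_cfc hA.1]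
    refine Tendsto.congr' h1.symm ?_
    have h2 : phi 0 A = (∏ i, hA.1.eigenvalues i) ^ (1 / (Fintype.card ι : ℝ)) := by
      rw [phi_zero hA, hA.1.det_eq_prod_eigenvalues]; rfl
    rw [h2]
    exact (tendsto_finsetProd _ fun i _ => hshift _).rpow_const (Or.inr (by positivity))
  · have h1 : (fun ε : ℝ => phi q (A + ε • (1 : Matrix ι ι ℝ))) =ᶠ[𝓝[>] 0]
        fun ε => ((1 / (Fintype.card ι : ℝ)) * ∑ i, (hA.1.eigenvalues i + ε) ^ q) ^ (1 / q) := by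
      filter_upwards [self_mem_nhdsWithin] with ε hε
      rw [phi_of_ne_zero hq0 (Or.inr (posDef_add_smul_one hA hε)), trace_matPow_add_smul_one hA.1]
    refine Tendsto.congr' h1.symm ?_
    by_cases hqA : 0 < q ∨ A.PosDef
    · rw [phi_of_ne_zero hq0 hqA, trace_matPow hA.1]
      refine (Tendsto.const_mul _ (tendsto_finsetSum _ fun i _ => (hshift _).rpow_const ?_)
        ).rpow_const ?_
      · rcases hqA with h | h
        · exact Or.inr h.le
        · exact Or.inl (h.eigenvalues_pos i).ne'
      · rcases hqA with h | h
        · exact Or.inr (one_div_pos.2 h).le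
        · have := trace_matPow_pos h q
          rw [trace_matPow h.1] at this
          exact Or.inl (by positivity)
    · push Not at hqA
      have hq : q < 0 := lt_of_le_of_ne hqA.1 hq0
      rw [phi_of_not_posDef hqA.1 hqA.2]
      obtain ⟨i₀, hi₀⟩ : ∃ i, hA.1.eigenvalues i = 0 := by
        have := hqA.2
        rw [hA.1.posDef_iff_eigenvalues_pos] at this
        push Not at this
        obtain ⟨i, hi⟩ := this
        exact ⟨i, le_antisymm hi (hA.eigenvalues_nonneg i)⟩
      -- one vanishing eigenvalue bounds the criterion by a multiple of `ε`
      have hlim : Tendsto (fun ε : ℝ => (1 / (Fintype.card ι : ℝ)) ^ (1 / q) * ε) (𝓝[>] 0)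
          (𝓝 0) := by
        have : Tendsto (fun ε : ℝ => (1 / (Fintype.card ι : ℝ)) ^ (1 / q) * ε) (𝓝 0)
          (𝓝 ((1 / (Fintype.card ι : ℝ)) ^ (1 / q) * 0)) := tendsto_const_nhds.mul tendsto_id
        rw [mul_zero] at this
        exact this.mono_left nhdsWithin_le_nhds
      refine tendsto_of_tendsto_of_tendsto_of_le_of_le' tendsto_const_nhds hlim ?_ ?_
      · filter_upwards [self_mem_nhdsWithin] with ε (hε : 0 < ε)
        have : ∀ i, 0 ≤ (hA.1.eigenvalues i + ε) ^ q := fun i =>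
          Real.rpow_nonneg (add_nonneg (hA.eigenvalues_nonneg i) hε.le) q
        have := Finset.sum_nonneg fun i (_ : i ∈ Finset.univ) => this i
        positivity
      · filter_upwards [self_mem_nhdsWithin] with ε (hε : 0 < ε)
        have hnn : ∀ i, 0 ≤ (hA.1.eigenvalues i + ε) ^ q := fun i =>
          Real.rpow_nonneg (add_nonneg (hA.eigenvalues_nonneg i) hε.le) q
        have h2 : ε ^ q ≤ ∑ i, (hA.1.eigenvalues i + ε) ^ q := by
          have := Finset.single_le_sum (fun i _ => hnn i) (Finset.mem_univ i₀)
          rwa [hi₀, zero_add] at this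
        have h3 : (1 / (Fintype.card ι : ℝ)) ^ (1 / q) * ε =
            ((1 / (Fintype.card ι : ℝ)) * ε ^ q) ^ (1 / q) := by
          rw [Real.mul_rpow (by positivity) (by positivity), ← Real.rpow_mul hε.le,
            mul_one_div_cancel hq0, Real.rpow_one]
        rw [h3]
        refine Real.rpow_le_rpow_of_nonpos (by positivity) ?_ (one_div_neg.2 hq).le
        gcongr

theorem continuous_support (q : ℝ) (M : Matrix ι ι ℝ) : Continuous (supportFunctional q M) := by
  unfold supportFunctional
  have : Continuous fun A : Matrix ι ι ℝ => (matPow M (q - 1) * A).trace :=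
    (continuous_const.matrix_mul continuous_id).matrix_trace
  fun_prop

theorem support_add_smul (q : ℝ) (M A B : Matrix ι ι ℝ) (s t : ℝ) :
    supportFunctional q M (s • A + t • B) =
      s * supportFunctional q M A + t * supportFunctional q M B := by
  simp only [supportFunctional, Matrix.mul_add, Matrix.mul_smul, Matrix.trace_add,
    Matrix.trace_smul, smul_eq_mul]
  ring

/-- The infimum of the supporting functionals at `A` is at most `φ_q(A)`; take `M = A + ε`. -/
theorem exists_support_lt [Nonempty ι] {q : ℝ} {A : Matrix ι ι ℝ}
    (hA : A.PosSemidef) {c : ℝ} (hc : phi q A < c) :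
    ∃ M : Matrix ι ι ℝ, M.PosDef ∧ supportFunctional q M A < c := by
  obtain ⟨ε, hε, hε0⟩ := (((tendsto_phi_add_smul_one q hA).eventually (gt_mem_nhds hc)).and
    self_mem_nhdsWithin).exists
  have hε0 : 0 < ε := hε0
  have hM := posDef_add_smul_one hA hε0
  refine ⟨_, hM, lt_of_le_of_lt ?_ hε⟩
  have h1 := support_add_smul q (A + ε • (1 : Matrix ι ι ℝ)) A 1 1 ε
  rw [one_smul, one_mul, support_self hM] at h1
  have h2 : 0 ≤ supportFunctional q (A + ε • (1 : Matrix ι ι ℝ)) 1 := by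
    rw [supportFunctional]
    have := trace_matPow_mul_nonneg hM Matrix.PosSemidef.one (q - 1)
    have := trace_matPow_pos hM q
    have := phi_pos q hM
    positivity
  nlinarith

theorem convex_posSemidef {κ : Type*} : Convex ℝ {A : Matrix κ κ ℝ | A.PosSemidef} :=
  fun _ hA _ hB _ _ hs ht _ =>
    Matrix.PosSemidef.add (Matrix.PosSemidef.smul hA hs) (Matrix.PosSemidef.smul hB ht)

theorem concaveOn_phi [Nonempty ι] {q : ℝ} (hq : q < 1) :
    ConcaveOn ℝ {A : Matrix ι ι ℝ | A.PosSemidef} (phi q) := by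
  refine ⟨convex_posSemidef, fun A hA B hB s t hs ht hst => ?_⟩
  refine le_of_forall_gt fun c hc => ?_
  obtain ⟨M, hM, hMc⟩ := exists_support_lt (convex_posSemidef hA hB hs ht hst) hc
  rw [support_add_smul] at hMc
  refine lt_of_le_of_lt ?_ hMc
  exact add_le_add (mul_le_mul_of_nonneg_left (phi_le_support_and_eq hq hM hA).1 hs)
    (mul_le_mul_of_nonneg_left (phi_le_support_and_eq hq hM hB).1 ht)

theorem upperSemicontinuousOn_phi [Nonempty ι] {q : ℝ} (hq : q < 1) :
    UpperSemicontinuousOn (phi q) {A : Matrix ι ι ℝ | A.PosSemidef} := by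
  intro A hA c hc
  obtain ⟨M, hM, hMc⟩ := exists_support_lt hA hc
  filter_upwards [((continuous_support q M).continuousAt.eventually (gt_mem_nhds hMc)).filter_mono
    nhdsWithin_le_nhds, self_mem_nhdsWithin] with B hB hB'
  exact lt_of_le_of_lt (phi_le_support_and_eq hq hM hB').1 hB

/-! ### Maximizers on segments -/

theorem posDef_segment {κ : Type*} {M Z : Matrix κ κ ℝ} (hM : M.PosSemidef) (hZ : Z.PosSemidef)
    {t : ℝ} (ht : t ∈ Set.Ioo (0 : ℝ) 1) (h : M.PosDef ∨ Z.PosDef) :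
    ((1 - t) • M + t • Z).PosDef := by
  have h1 : 0 < 1 - t := sub_pos.2 ht.2
  rcases h with h | h
  · exact (h.smul h1).add_posSemidef (hZ.smul ht.1.le)
  · exact Matrix.PosDef.posSemidef_add (hM.smul h1.le) (h.smul ht.1)

/-- The first-order condition for a maximum at `M` in the direction of `Z`. At a point `C` of the
segment, `φ_q(C) ≤ φ_q(M) ≤ ℓ_C(M)` gives `trace (C ^ (q - 1) (Z - M)) ≤ 0`; then let `C → M`. -/
theorem trace_matPow_mul_le_of_isMax [Nonempty ι] {q : ℝ} (hq : q < 1) {M Z : Matrix ι ι ℝ}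
    (hM : M.PosDef) (hZ : Z.PosSemidef)
    (hmax : ∀ t ∈ Set.Ioo (0 : ℝ) 1, phi q ((1 - t) • M + t • Z) ≤ phi q M) :
    (matPow M (q - 1) * Z).trace ≤ (matPow M q).trace := by
  rw [← trace_matPow_mul_self hM]
  have hseg : ∀ t ∈ Set.Ioo (0 : ℝ) 1, ((1 - t) • M + t • Z).PosDef := fun t ht =>
    posDef_segment hM.posSemidef hZ ht (Or.inl hM)
  have hle : ∀ t ∈ Set.Ioo (0 : ℝ) 1, (matPow ((1 - t) • M + t • Z) (q - 1) * Z).trace ≤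
      (matPow ((1 - t) • M + t • Z) (q - 1) * M).trace := fun t ht => by
    set C := (1 - t) • M + t • Z with hC
    have hCp : C.PosDef := hseg t ht
    have h1 := (phi_le_support_and_eq hq hCp hM.posSemidef).1.trans' (hmax t ht)
    have h2 := phi_pos q hCp
    have h3 := trace_matPow_pos hCp q
    rw [supportFunctional, le_mul_iff_one_le_right h2, one_le_div h3,
      ← trace_matPow_mul_self hCp] at h1
    have h4 : ∀ B : Matrix ι ι ℝ, (B * C).trace = (1 - t) * (B * M).trace + t * (B * Z).trace :=
      fun B => by
        simp only [hC, Matrix.mul_add, Matrix.mul_smul, Matrix.trace_add, Matrix.trace_smul,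
          smul_eq_mul]
    rw [h4] at h1
    have := ht.1
    nlinarith
  have hcurve : Tendsto (fun t : ℝ => (1 - t) • M + t • Z) (𝓝[>] 0) (𝓝[{M | M.PosDef}] M) := by
    refine tendsto_nhdsWithin_iff.2 ⟨?_, ?_⟩
    · have : Continuous fun t : ℝ => (1 - t) • M + t • Z := by fun_prop
      have := this.tendsto 0
      simp only [sub_zero, one_smul, zero_smul, add_zero] at this
      exact this.mono_left nhdsWithin_le_nhds
    · filter_upwards [Ioo_mem_nhdsGT one_pos] with t ht using hseg t ht
  have hpow : Tendsto (fun t : ℝ => matPow ((1 - t) • M + t • Z) (q - 1)) (𝓝[>] 0)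
      (𝓝 (matPow M (q - 1))) := (continuousOn_matPow (q - 1) M hM).tendsto.comp hcurve
  have htr : ∀ N : Matrix ι ι ℝ, Tendsto
      (fun t : ℝ => (matPow ((1 - t) • M + t • Z) (q - 1) * N).trace) (𝓝[>] 0)
      (𝓝 (matPow M (q - 1) * N).trace) := fun N => by
    have : Continuous fun B : Matrix ι ι ℝ => (B * N).trace :=
      (continuous_id.matrix_mul continuous_const).matrix_trace
    exact (this.tendsto _).comp hpow
  refine le_of_tendsto_of_tendsto (htr Z) (htr M) ?_
  filter_upwards [Ioo_mem_nhdsGT one_pos] with t ht using hle t ht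

/-- The trace of `M ^ q` is monotone in the Loewner order. -/
theorem trace_matPow_mono {q : ℝ} (hq0 : 0 < q) (hq1 : q < 1) {A C : Matrix ι ι ℝ}
    (hA : A.PosSemidef) (hC : C.PosDef) (hAC : (C - A).PosSemidef) :
    (matPow A q).trace ≤ (matPow C q).trace := by
  have h1 := trace_cfc_add_nonneg hC.1 hA.1 (f := fun a : ℝ => -q⁻¹ * a ^ q)
    (g := fun m : ℝ => q⁻¹ * (1 - q) * m ^ q) (h := fun m : ℝ => m ^ (q - 1)) fun j i =>
      (tangent_deficit hq0.ne' hq1 (hA.eigenvalues_nonneg i) (hC.eigenvalues_pos j)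
        (Or.inl hq0)).1
  rw [trace_cfc_const_mul, trace_cfc_const_mul] at h1
  change 0 ≤ -q⁻¹ * (matPow A q).trace + q⁻¹ * (1 - q) * (matPow C q).trace +
    (matPow C (q - 1) * A).trace at h1
  have h2 := trace_matPow_mul_nonneg hC hAC (q - 1)
  rw [Matrix.mul_sub, Matrix.trace_sub, trace_matPow_mul_self hC] at h2
  have h3 : 0 ≤ q⁻¹ * ((matPow C q).trace - (matPow A q).trace) := by
    have : q⁻¹ * (1 - q) = q⁻¹ - 1 := by field_simp
    rw [this] at h1
    linarith
  have := nonneg_of_mul_nonneg_right h3 (inv_pos.2 hq0)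
  linarith

/-- A maximizer of `φ_q` on a segment towards a positive definite matrix is positive definite. For
`0 < q` a vanishing eigenvalue of `M` would give a gain of order `t ^ q` along the segment, against
a loss of order `t`. -/
theorem posDef_of_isMax [Nonempty ι] {q : ℝ} (hq1 : q < 1) {M Z : Matrix ι ι ℝ}
    (hM : M.PosSemidef) (hZ : Z.PosDef)
    (hmax : ∀ t ∈ Set.Ioo (0 : ℝ) 1, phi q ((1 - t) • M + t • Z) ≤ phi q M) : M.PosDef := by
  by_contra hMs
  have hp : (0 : ℝ) < Fintype.card ι := by exact_mod_cast Fintype.card_pos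
  have hseg : ∀ t ∈ Set.Ioo (0 : ℝ) 1, ((1 - t) • M + t • Z).PosDef := fun t ht =>
    posDef_segment hM hZ.posSemidef ht (Or.inr hZ)
  rcases le_or_gt q 0 with hq0 | hq0
  · have h1 := hmax (1 / 2) (by norm_num)
    rw [phi_of_not_posDef hq0 hMs] at h1
    exact absurd (phi_pos q (hseg (1 / 2) (by norm_num))) (not_lt.2 h1)
  · obtain ⟨i₀, hi₀⟩ : ∃ i, hM.1.eigenvalues i = 0 := by
      rw [hM.1.posDef_iff_eigenvalues_pos] at hMs
      push Not at hMs
      obtain ⟨i, hi⟩ := hMs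
      exact ⟨i, le_antisymm hi (hM.eigenvalues_nonneg i)⟩
    -- the smallest eigenvalue `r` of `Z`
    obtain ⟨r, hr, hZr⟩ : ∃ r : ℝ, 0 < r ∧ (Z - r • (1 : Matrix ι ι ℝ)).PosSemidef := by
      obtain ⟨k, -, hk⟩ := Finset.exists_min_image Finset.univ hZ.1.eigenvalues
        Finset.univ_nonempty
      refine ⟨hZ.1.eigenvalues k, hZ.eigenvalues_pos k, ?_⟩
      rw [sub_eq_add_neg, ← neg_smul, add_smul_one_eq_cfc hZ.1, cfc_eq_conj hZ.1]
      refine Matrix.PosSemidef.mul_mul_conjTranspose_same (Matrix.PosSemidef.diagonal ?_) _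
      intro i
      have := hk i (Finset.mem_univ i)
      simp only [Function.comp_apply, Pi.zero_apply]
      linarith
    set S := (matPow M q).trace with hS
    have hS0 : S = ∑ i, hM.1.eigenvalues i ^ q := trace_matPow hM.1 q
    have hSnn : 0 ≤ S := by
      rw [hS0]
      exact Finset.sum_nonneg fun i _ => Real.rpow_nonneg (hM.eigenvalues_nonneg i) q
    -- on the segment, `(1 - t) M + t Z ≥ (1 - t) M + t r`, and the eigenvalue `0` contributes
    -- `(t r) ^ q` to the trace of the power of the right-hand side
    have hbound : ∀ t ∈ Set.Ioo (0 : ℝ) 1, (t * r) ^ q ≤ S * t := fun t ht => by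
      have ht1 : 0 < 1 - t := sub_pos.2 ht.2
      have h1 := hmax t ht
      have hCp := hseg t ht
      rw [phi_of_ne_zero hq0.ne' (Or.inl hq0), phi_of_ne_zero hq0.ne' (Or.inl hq0)] at h1
      have hCt := trace_matPow_pos hCp q
      rw [Real.rpow_le_rpow_iff (by positivity) (by positivity) (one_div_pos.2 hq0),
        mul_le_mul_iff_right₀ (one_div_pos.2 hp)] at h1
      have hM' : ((1 - t) • M).PosSemidef := hM.smul ht1.le
      have h2 := trace_matPow_mono hq0 hq1
        (posDef_add_smul_one hM' (mul_pos ht.1 hr)).posSemidef hCp (by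
          have : (1 - t) • M + t • Z - ((1 - t) • M + (t * r) • (1 : Matrix ι ι ℝ)) =
            t • (Z - r • (1 : Matrix ι ι ℝ)) := by
            rw [smul_sub, smul_smul]; abel
          rw [this]
          exact hZr.smul ht.1.le)
      have h3 : (matPow ((1 - t) • M + (t * r) • (1 : Matrix ι ι ℝ)) q).trace =
          ∑ i, ((1 - t) * hM.1.eigenvalues i + t * r) ^ q := by
        have : (1 - t) • M + (t * r) • (1 : Matrix ι ι ℝ) =
            cfc (fun x : ℝ => (1 - t) * x + t * r) M := by
          rw [cfc_add_const (t * r) (fun x => (1 - t) * x) M (continuousOn_spectrum M _)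
            hM.1.isSelfAdjoint, cfc_const_mul_id _ M hM.1.isSelfAdjoint,
            Algebra.algebraMap_eq_smul_one]
        rw [this, matPow, ← cfc_comp' (fun x : ℝ => x ^ q) (fun x : ℝ => (1 - t) * x + t * r) M
          (((M.finite_real_spectrum).image _).continuousOn _) (continuousOn_spectrum M _)
          hM.1.isSelfAdjoint, trace_cfc hM.1]
      have h4 : ∑ i, (((1 - t) * hM.1.eigenvalues i) ^ q + if i = i₀ then (t * r) ^ q else 0) ≤
          ∑ i, ((1 - t) * hM.1.eigenvalues i + t * r) ^ q := by
        refine Finset.sum_le_sum fun i _ => ?_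
        have := hM.eigenvalues_nonneg i
        have htr : 0 < t * r := mul_pos ht.1 hr
        split_ifs with hi
        · rw [hi, hi₀, mul_zero, zero_add, Real.zero_rpow hq0.ne', zero_add]
        · rw [add_zero]
          exact Real.rpow_le_rpow (by positivity) (by linarith) hq0.le
      rw [Finset.sum_add_distrib, Finset.sum_ite_eq' Finset.univ i₀, if_pos (Finset.mem_univ _)]
        at h4
      have h5 : ∑ i, ((1 - t) * hM.1.eigenvalues i) ^ q = (1 - t) ^ q * S := by
        rw [hS0, Finset.mul_sum]
        exact Finset.sum_congr rfl fun i _ => Real.mul_rpow ht1.le (hM.eigenvalues_nonneg i)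
      have h6 : 1 - t ≤ (1 - t) ^ q := by
        conv_lhs => rw [← Real.rpow_one (1 - t)]
        exact Real.rpow_le_rpow_of_exponent_ge ht1 (by linarith [ht.1]) hq1.le
      rw [h5] at h4
      rw [h3] at h2
      nlinarith
    -- but `t ^ q` dominates `t` near `0`
    have hlim : Tendsto (fun t : ℝ => S * t ^ (1 - q)) (𝓝[>] 0) (𝓝 0) := by
      have : Tendsto (fun t : ℝ => t ^ (1 - q)) (𝓝 0) (𝓝 ((0 : ℝ) ^ (1 - q))) :=
        tendsto_id.rpow_const (Or.inr (sub_pos.2 hq1).le)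
      rw [Real.zero_rpow (sub_pos.2 hq1).ne'] at this
      have := (this.const_mul S).mono_left (nhdsWithin_le_nhds (s := Set.Ioi 0))
      rwa [mul_zero] at this
    have hle : r ^ q ≤ 0 := by
      refine ge_of_tendsto hlim ?_
      filter_upwards [Ioo_mem_nhdsGT one_pos] with t ht
      have h1 := hbound t ht
      have htq := Real.rpow_pos_of_pos ht.1 q
      rw [Real.mul_rpow ht.1.le hr.le] at h1
      rw [Real.rpow_sub ht.1, Real.rpow_one, mul_div_assoc', le_div_iff₀ htq]
      linarith
    exact absurd (Real.rpow_pos_of_pos hr q) (not_lt.2 hle)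

end Spectral

/-! ### Monomials of bounded degree -/

instance nonempty_expo (n k : ℕ) : Nonempty (expo n k) := ⟨zeroExpo n k⟩

/-- Exponents of degree at most `k` in `n` variables correspond to exponents of degree exactly `k`
in `n + 1` variables. -/
def expoEquiv (n k : ℕ) : expo n k ≃ {P : Fin (n + 1) → ℕ // ∑ i, P i = k} where
  toFun α := ⟨Fin.cons (k - ∑ i, α.1 i) α.1, by
    have := mem_expo.1 α.2
    rw [Fin.sum_univ_succ, Fin.cons_zero]
    simp only [Fin.cons_succ]
    omega⟩
  invFun P := ⟨fun i => P.1 i.succ, mem_expo.2 (by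
    have := P.2
    rw [Fin.sum_univ_succ] at this
    omega)⟩
  left_inv α := by simp
  right_inv P := by
    have := P.2
    rw [Fin.sum_univ_succ] at this
    refine Subtype.ext (funext fun i => ?_)
    refine Fin.cases ?_ (fun j => ?_) i
    · simp only [Fin.cons_zero]; omega
    · simp

theorem card_expo (n k : ℕ) : Fintype.card (expo n k) = (n + k).choose n := by
  rw [Fintype.card_congr ((expoEquiv n k).trans (Sym.equivNatSumOfFintype (Fin (n + 1)) k).symm),
    Sym.card_sym_eq_choose, Fintype.card_fin, Nat.choose_symm_of_eq_add]
  · congr 1; omega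
  · omega

theorem mono_add {n : ℕ} (α β : Fin n → ℕ) (x : Fin n → ℝ) :
    mono (α + β) x = mono α x * mono β x := by
  simp [mono, pow_add, Finset.prod_mul_distrib]

theorem monoVec_zeroExpo {n k : ℕ} (x : Fin n → ℝ) : monoVec k x (zeroExpo n k) = 1 := by
  simp [monoVec, mono, zeroExpo]

theorem continuous_mono {n : ℕ} (α : Fin n → ℕ) : Continuous (mono α) := by
  unfold mono; fun_prop

theorem continuous_monoVec (n k : ℕ) : Continuous (monoVec k : (Fin n → ℝ) → expo n k → ℝ) :=
  continuous_pi fun α => continuous_mono α.1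

/-- A polynomial of bounded degree which vanishes on a set with nonempty interior is zero. -/
theorem eq_zero_of_dotProduct_monoVec {n d : ℕ} {X : Set (Fin n → ℝ)} (hX : (interior X).Nonempty)
    {c : expo n d → ℝ} (hc : ∀ x ∈ X, c ⬝ᵥ monoVec d x = 0) : c = 0 := by
  let e : expo n d → (Fin n →₀ ℕ) := fun α => Finsupp.equivFunOnFinite.symm α.1
  have he : Function.Injective e := fun α β h =>
    Subtype.ext (Finsupp.equivFunOnFinite.symm.injective h)
  let P : MvPolynomial (Fin n) ℝ := ∑ α, MvPolynomial.monomial (e α) (c α)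
  have hP : ∀ x, MvPolynomial.eval x P = c ⬝ᵥ monoVec d x := fun x => by
    simp only [P, map_sum, MvPolynomial.eval_monomial, dotProduct, monoVec, mono]
    refine Finset.sum_congr rfl fun α _ => ?_
    rw [Finsupp.prod_fintype _ _ fun i => pow_zero _]
    rfl
  obtain ⟨x₀, hx₀⟩ := hX
  obtain ⟨r, hr, hball⟩ := Metric.isOpen_iff.1 isOpen_interior x₀ hx₀
  have hP0 : P = 0 := by
    refine MvPolynomial.funext_set (fun i => Set.Ioo (x₀ i - r) (x₀ i + r))
      (fun i => Set.Ioo_infinite (by linarith)) fun x hx => ?_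
    rw [hP, map_zero]
    refine hc x (interior_subset (hball ?_))
    rw [Metric.mem_ball, dist_pi_lt_iff hr]
    intro i
    have := hx i (Set.mem_univ i)
    rw [Real.dist_eq, abs_lt]
    constructor <;> linarith [this.1, this.2]
  funext α
  have h1 : MvPolynomial.coeff (e α) P = c α := by
    simp only [P, MvPolynomial.coeff_sum, MvPolynomial.coeff_monomial, he.eq_iff]
    simp
  rw [← h1, hP0, MvPolynomial.coeff_zero, Pi.zero_apply]

/-- The monomial vectors of the points of `X` span, as no nonzero polynomial vanishes on `X`. -/
theorem span_monoVec {n d : ℕ} {X : Set (Fin n → ℝ)} (hX : (interior X).Nonempty) :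
    Submodule.span ℝ (monoVec d '' X : Set (expo n d → ℝ)) = ⊤ := by
  by_contra hne
  obtain ⟨f, hf, hle⟩ := Submodule.exists_le_ker_of_lt_top _ (lt_top_iff_ne_top.2 hne)
  have hfv : ∀ v : expo n d → ℝ, f v = (fun α => f (Pi.single α 1)) ⬝ᵥ v := fun v => by
    rw [LinearMap.pi_apply_eq_sum_univ f v, dotProduct]
    refine Finset.sum_congr rfl fun α _ => ?_
    rw [smul_eq_mul, mul_comm]
    congr 3
    ext β
    simp [Pi.single_apply, eq_comm]
  have hc := eq_zero_of_dotProduct_monoVec hX (c := fun α => f (Pi.single α 1)) fun x hx => by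
    rw [← hfv]
    exact hle (Submodule.subset_span ⟨x, hx, rfl⟩)
  refine hf (LinearMap.ext fun v => ?_)
  rw [hfv, hc, zero_dotProduct, LinearMap.zero_apply]

/-! ### Moment matrices -/

theorem isLinearMap_momentMatrix {n d : ℕ} :
    IsLinearMap ℝ (momentMatrix : (expo n (2 * d) → ℝ) → Matrix (expo n d) (expo n d) ℝ) :=
  ⟨fun _ _ => rfl, fun _ _ => rfl⟩

theorem momentMatrix_monoVec {n d : ℕ} (x : Fin n → ℝ) :
    momentMatrix (monoVec (2 * d) x) = Matrix.vecMulVec (monoVec d x) (monoVec d x) := by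
  ext α β
  exact mono_add α.1 β.1 x

/-- Every exponent of degree at most `2 * d` is a sum of two exponents of degree at most `d`. -/
theorem exists_addExpo_eq {n d : ℕ} (γ : expo n (2 * d)) :
    ∃ α β : expo n d, addExpo α β = γ := by
  have split : ∀ (m : ℕ) (γ : Fin n → ℕ), m ≤ ∑ i, γ i → ∃ α ≤ γ, ∑ i, α i = m := by
    intro m γ
    induction m with
    | zero => exact fun _ => ⟨0, fun i => Nat.zero_le _, by simp⟩
    | succ m ih =>
      intro hm
      obtain ⟨α, hα, hs⟩ := ih (by omega)
      obtain ⟨i, -, hi⟩ := Finset.exists_lt_of_sum_lt (s := Finset.univ) (f := α) (g := γ)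
        (by omega)
      refine ⟨α + Pi.single i 1, fun j => ?_, ?_⟩
      · by_cases hji : j = i
        · subst hji; simpa using hi
        · simpa [hji] using hα j
      · simp [Finset.sum_add_distrib, hs]
  have hγ := mem_expo.1 γ.2
  obtain ⟨α, hα, hs⟩ := split (min d (∑ i, γ.1 i)) γ.1 (min_le_right _ _)
  refine ⟨⟨α, mem_expo.2 (by omega)⟩, ⟨γ.1 - α, mem_expo.2 ?_⟩, Subtype.ext ?_⟩
  · have : ∑ i, (γ.1 - α) i + ∑ i, α i = ∑ i, γ.1 i := by
      rw [← Finset.sum_add_distrib]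
      exact Finset.sum_congr rfl fun i _ => Nat.sub_add_cancel (hα i)
    omega
  · exact funext fun i => Nat.add_sub_cancel' (hα i)

theorem momentMatrix_injective {n d : ℕ} :
    Function.Injective
      (momentMatrix : (expo n (2 * d) → ℝ) → Matrix (expo n d) (expo n d) ℝ) := by
  intro y z h
  funext γ
  obtain ⟨α, β, rfl⟩ := exists_addExpo_eq γ
  exact congrFun (congrFun h α) β

theorem trace_mul_momentMatrix_monoVec {n d : ℕ} (B : Matrix (expo n d) (expo n d) ℝ)
    (x : Fin n → ℝ) : (B * momentMatrix (monoVec (2 * d) x)).trace =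
      monoVec d x ⬝ᵥ B.mulVec (monoVec d x) := by
  rw [momentMatrix_monoVec, Matrix.mul_vecMulVec, Matrix.trace_vecMulVec, dotProduct_comm]

theorem isLinearMap_trace_mul_momentMatrix {n d : ℕ} (B : Matrix (expo n d) (expo n d) ℝ) :
    IsLinearMap ℝ fun y : expo n (2 * d) → ℝ => (B * momentMatrix y).trace :=
  ⟨fun y z => by rw [isLinearMap_momentMatrix.map_add, Matrix.mul_add, Matrix.trace_add],
    fun c y => by rw [isLinearMap_momentMatrix.map_smul, Matrix.mul_smul, Matrix.trace_smul]⟩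

/-! ### Compactness of convex hulls and atomic representations -/

/-- In finite dimension the convex hull of a compact set is compact: by Carathéodory's theorem it
is a finite union of continuous images of products of a simplex with powers of the set. -/
theorem isCompact_convexHull {E : Type*} [AddCommGroup E] [Module ℝ E] [TopologicalSpace E]
    [ContinuousAdd E] [ContinuousSMul ℝ E] [FiniteDimensional ℝ E] {s : Set E} (hs : IsCompact s) :
    IsCompact (convexHull ℝ s) := by
  let F : (m : ℕ) → (Fin m → ℝ) × (Fin m → E) → E := fun m p => ∑ i, p.1 i • p.2 i
  have hF : ∀ m, Continuous (F m) := fun m => by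
    simp only [F]; fun_prop
  have heq : convexHull ℝ s = ⋃ m ∈ Finset.range (Module.finrank ℝ E + 2),
      F m '' (stdSimplex ℝ (Fin m) ×ˢ Set.univ.pi fun _ => s) := by
    refine Set.Subset.antisymm (fun y hy => ?_) ?_
    · obtain ⟨ι, _, z, w, hz, haff, hw, hw1, rfl⟩ := eq_pos_convex_span_of_mem_convexHull hy
      have hcard := haff.card_le_finrank_succ
      have hle := Submodule.finrank_le (vectorSpan ℝ (Set.range z))
      refine Set.mem_iUnion₂.2 ⟨Fintype.card ι, Finset.mem_range.2 (by omega), ?_⟩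
      let e := (Fintype.equivFin ι).symm
      refine ⟨(w ∘ e, z ∘ e), ⟨⟨fun i => (hw _).le, ?_⟩, fun i _ => hz ⟨_, rfl⟩⟩, ?_⟩
      · exact (Equiv.sum_comp e w).trans hw1
      · exact Equiv.sum_comp e fun i => w i • z i
    · refine Set.iUnion₂_subset fun m _ => ?_
      rintro _ ⟨⟨w, z⟩, ⟨⟨hw, hw1⟩, hz⟩, rfl⟩
      exact (convex_convexHull ℝ s).sum_mem (fun i _ => hw i) hw1 fun i _ =>
        subset_convexHull ℝ s (hz i (Set.mem_univ i))
  rw [heq]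
  exact Finset.isCompact_biUnion _ fun m _ =>
    ((isCompact_stdSimplex ℝ (Fin m)).prod (isCompact_univ_pi fun _ => hs)).image (hF m)

/-- Carathéodory's theorem for moment vectors: since `y₀ = 1` on the monomial curve, affinely
independent points of it are linearly independent. -/
theorem exists_atoms {n k : ℕ} {X : Set (Fin n → ℝ)} {y : expo n k → ℝ}
    (hy : y ∈ convexHull ℝ (monoVec k '' X)) :
    ∃ (S : Finset (Fin n → ℝ)) (w : (Fin n → ℝ) → ℝ≥0),
      S.card ≤ (n + k).choose n ∧ (∀ x ∈ S, x ∈ X) ∧ (∀ x ∈ S, 0 < w x) ∧ ∑ x ∈ S, w x = 1 ∧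
        y = ∑ x ∈ S, (w x : ℝ) • monoVec k x := by
  classical
  obtain ⟨ι, _, z, w, hz, haff, hw, hw1, rfl⟩ := eq_pos_convex_span_of_mem_convexHull hy
  have hz' : ∀ i, ∃ x ∈ X, monoVec k x = z i := fun i => hz ⟨i, rfl⟩
  choose x hxX hxz using hz'
  have hxinj : Function.Injective x := fun i j hij =>
    haff.injective (by rw [← hxz i, ← hxz j, hij])
  have hlin : LinearIndependent ℝ z := by
    rw [Fintype.linearIndependent_iff]
    intro c hc i
    refine affineIndependent_iff.1 haff Finset.univ c ?_ hc i (Finset.mem_univ i)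
    have := congrFun hc (zeroExpo n k)
    simpa [← hxz, monoVec_zeroExpo] using this
  have hcard : Fintype.card ι ≤ (n + k).choose n := by
    have := hlin.fintype_card_le_finrank
    rwa [Module.finrank_fintype_fun_eq_card, card_expo] at this
  let W : (Fin n → ℝ) → ℝ≥0 := Function.extend x (fun i => (w i).toNNReal) 0
  have hW : ∀ i, W (x i) = (w i).toNNReal := fun i => hxinj.extend_apply _ _ i
  have hW' : ∀ i, (W (x i) : ℝ) = w i := fun i => by rw [hW, Real.coe_toNNReal _ (hw i).le]
  refine ⟨Finset.univ.map ⟨x, hxinj⟩, W, ?_, ?_, ?_, ?_, ?_⟩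
  · rwa [Finset.card_map]
  · simpa using hxX
  · simp only [Finset.mem_map, Finset.mem_univ, true_and, Function.Embedding.coeFn_mk,
      forall_exists_index, forall_apply_eq_imp_iff, hW]
    exact fun i => Real.toNNReal_pos.2 (hw i)
  · rw [Finset.sum_map, ← NNReal.coe_inj, NNReal.coe_sum]
    simpa only [Function.Embedding.coeFn_mk, hW', NNReal.coe_one] using hw1
  · rw [Finset.sum_map]
    simp only [Function.Embedding.coeFn_mk, hW', hxz]

theorem integral_discreteMeasure {n : ℕ} (S : Finset (Fin n → ℝ)) (w : (Fin n → ℝ) → ℝ≥0)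
    (f : (Fin n → ℝ) → ℝ) : ∫ x, f x ∂(discreteMeasure S w) = ∑ x ∈ S, (w x : ℝ) * f x := by
  rw [discreteMeasure, integral_finsetSum_measure]
  · simp [integral_smul_nnreal_measure, NNReal.smul_def]
  · intro x _
    exact (integrable_dirac (by simp)).smul_measure_nnreal

theorem isMomentVector_discreteMeasure {n k : ℕ} (S : Finset (Fin n → ℝ))
    (w : (Fin n → ℝ) → ℝ≥0) :
    IsMomentVector (∑ x ∈ S, (w x : ℝ) • monoVec k x) (discreteMeasure S w) := fun α => by
  rw [integral_discreteMeasure]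
  simp [monoVec]

/-- The feasible moment vectors are the convex combinations of points of the monomial curve. -/
theorem feasibleSet_eq_convexHull {n d : ℕ} {X : Set (Fin n → ℝ)} (hX : IsCompact X) :
    feasibleSet d X = convexHull ℝ (monoVec (2 * d) '' X) := by
  refine Set.Subset.antisymm ?_ fun y hy => ?_
  · rintro y ⟨⟨μ, hμ, hμX, hy⟩, hy0⟩
    have hprob : IsProbabilityMeasure μ := by
      have := hy (zeroExpo n (2 * d))
      rw [hy0] at this
      simp only [zeroExpo, mono, Pi.zero_apply, pow_zero, Finset.prod_const_one, integral_const,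
        smul_eq_mul, mul_one] at this
      refine ⟨?_⟩
      rw [measureReal_def, eq_comm, ENNReal.toReal_eq_one_iff] at this
      exact this
    have hae : ∀ᵐ x ∂μ, x ∈ X := hμX
    have hint : ∀ α : expo n (2 * d), Integrable (fun x => monoVec (2 * d) x α) μ := fun α => by
      have hc : Continuous fun x : Fin n → ℝ => monoVec (2 * d) x α := continuous_mono α.1
      obtain ⟨C, hC⟩ := hX.exists_bound_of_continuousOn hc.continuousOn
      exact Integrable.of_bound hc.aestronglyMeasurable C (hae.mono fun x hx => hC x hx)
    have hmem := (convex_convexHull ℝ (monoVec (2 * d) '' X)).integral_mem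
      (isCompact_convexHull (hX.image (continuous_monoVec n (2 * d)))).isClosed
      (hae.mono fun x hx => subset_convexHull ℝ _ ⟨x, hx, rfl⟩) (Integrable.of_eval hint)
    convert hmem using 1
    funext α
    rw [eval_integral hint]
    exact hy α
  · obtain ⟨S, w, -, hSX, -, hw1, rfl⟩ := exists_atoms hy
    refine ⟨⟨discreteMeasure S w, ?_, ?_, isMomentVector_discreteMeasure S w⟩, ?_⟩
    · unfold discreteMeasure; infer_instance
    · rw [discreteMeasure, Measure.finsetSum_apply]
      refine Finset.sum_eq_zero fun x hx => ?_
      rw [Measure.smul_apply, Measure.dirac_apply' _ hX.measurableSet.compl]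
      simp [hSX x hx]
    · have : ((∑ x ∈ S, w x : ℝ≥0) : ℝ) = 1 := by rw [hw1]; rfl
      simpa [monoVec_zeroExpo] using this

theorem momentMatrix_posSemidef {n d : ℕ} {X : Set (Fin n → ℝ)} {y : expo n (2 * d) → ℝ}
    (hy : y ∈ convexHull ℝ (monoVec (2 * d) '' X)) : (momentMatrix y).PosSemidef := by
  have hconv : Convex ℝ {y : expo n (2 * d) → ℝ | (momentMatrix y).PosSemidef} :=
    convex_posSemidef.is_linear_preimage isLinearMap_momentMatrix
  refine convexHull_min ?_ hconv hy
  rintro _ ⟨x, -, rfl⟩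
  change (momentMatrix _).PosSemidef
  rw [momentMatrix_monoVec]
  exact Matrix.posSemidef_vecMulVec_self_star (monoVec d x)

/-- The quadratic form of an atomic moment matrix, at the coefficient vector `c` of a polynomial. -/
theorem dotProduct_momentMatrix_mulVec {n d : ℕ} {κ : Type*} (S : Finset κ)
    (p : κ → Fin n → ℝ) (w : κ → ℝ) (c : expo n d → ℝ) :
    c ⬝ᵥ (momentMatrix (∑ i ∈ S, w i • monoVec (2 * d) (p i))).mulVec c =
      ∑ i ∈ S, w i * (c ⬝ᵥ monoVec d (p i)) ^ 2 := by
  have h1 : momentMatrix (∑ i ∈ S, w i • monoVec (2 * d) (p i)) =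
      ∑ i ∈ S, w i • Matrix.vecMulVec (monoVec d (p i)) (monoVec d (p i)) := by
    have := map_sum (isLinearMap_momentMatrix (n := n) (d := d)).mk'
      (fun i => w i • monoVec (2 * d) (p i)) S
    simp only [map_smul, IsLinearMap.mk'_apply, momentMatrix_monoVec] at this
    exact this
  rw [h1, Matrix.sum_mulVec, dotProduct_sum]
  refine Finset.sum_congr rfl fun i _ => ?_
  rw [Matrix.smul_mulVec, dotProduct_smul, Matrix.vecMulVec_mulVec, op_smul_eq_smul,
    dotProduct_smul, dotProduct_comm (monoVec d (p i)) c, smul_eq_mul, smul_eq_mul]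
  ring

/-- Averaging over finitely many points of `X` whose monomial vectors span the whole space gives a
feasible vector with a positive definite moment matrix. -/
theorem exists_posDef_momentMatrix {n : ℕ} (d : ℕ) {X : Set (Fin n → ℝ)}
    (hX : (interior X).Nonempty) :
    ∃ z ∈ convexHull ℝ (monoVec (2 * d) '' X), (momentMatrix z).PosDef := by
  obtain ⟨f, hf, hspan, -⟩ := Submodule.exists_fun_fin_finrank_span_eq ℝ
    (monoVec d '' X : Set (expo n d → ℝ))
  replace hspan := hspan.trans (span_monoVec hX)
  have hmpos : 0 < Module.finrank ℝ (Submodule.span ℝ (monoVec d '' X : Set (expo n d → ℝ))) := by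
    rw [span_monoVec hX, finrank_top, Module.finrank_fintype_fun_eq_card]
    exact Fintype.card_pos
  generalize Module.finrank ℝ (Submodule.span ℝ (monoVec d '' X : Set (expo n d → ℝ))) = m
    at f hf hspan hmpos
  choose x hxX hxf using hf
  have hm : (0 : ℝ) < m := by exact_mod_cast hmpos
  have hzmem : ∑ i, (1 / (m : ℝ)) • monoVec (2 * d) (x i) ∈
      convexHull ℝ (monoVec (2 * d) '' X) := by
    refine (convex_convexHull ℝ _).sum_mem (fun i _ => by positivity) ?_ fun i _ =>
      subset_convexHull ℝ _ ⟨x i, hxX i, rfl⟩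
    simp [hm.ne']
  refine ⟨_, hzmem, Matrix.PosDef.of_dotProduct_mulVec_pos (momentMatrix_posSemidef hzmem).1
    fun c hc => ?_⟩
  rw [star_trivial, dotProduct_momentMatrix_mulVec Finset.univ x (fun _ => 1 / (m : ℝ))]
  have hnn : ∀ i ∈ Finset.univ, 0 ≤ 1 / (m : ℝ) * (c ⬝ᵥ monoVec d (x i)) ^ 2 := fun i _ => by
    positivity
  refine lt_of_le_of_ne (Finset.sum_nonneg hnn) fun h0 => hc ?_
  have h1 := (Finset.sum_eq_zero_iff_of_nonneg hnn).1 h0.symm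
  have h2 : ∀ i, c ⬝ᵥ f i = 0 := fun i => by
    have := h1 i (Finset.mem_univ i)
    rw [mul_eq_zero, or_iff_right (by positivity), sq_eq_zero_iff, hxf] at this
    exact this
  have h3 : Submodule.span ℝ (Set.range f) ≤ LinearMap.ker (dotProductBilin ℝ ℝ c) := by
    rw [Submodule.span_le]
    rintro _ ⟨i, rfl⟩
    exact h2 i
  rw [hspan] at h3
  exact dotProduct_self_eq_zero.1 (h3 (Submodule.mem_top (x := c)))

/-- A positive definite moment matrix needs at least as many atoms as it has rows: with fewer, some
nonzero polynomial of degree at most `d` would vanish on all of them. -/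
theorem card_expo_le_of_posDef {n d : ℕ} {S : Finset (Fin n → ℝ)} {w : (Fin n → ℝ) → ℝ}
    (h : (momentMatrix (∑ x ∈ S, w x • monoVec (2 * d) x)).PosDef) :
    (n + d).choose n ≤ S.card := by
  let L : (expo n d → ℝ) →ₗ[ℝ] (S → ℝ) := LinearMap.pi fun x =>
    (dotProductBilin ℝ ℝ).flip (monoVec d x.1)
  have hL : Function.Injective L := by
    rw [← LinearMap.ker_eq_bot, LinearMap.ker_eq_bot']
    intro c hc
    by_contra hne
    have h1 := h.dotProduct_mulVec_pos hne
    rw [star_trivial] at h1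
    replace h1 := h1.trans_eq (dotProduct_momentMatrix_mulVec S (fun x => x) w c)
    refine h1.ne' (Finset.sum_eq_zero fun x hx => ?_)
    have : c ⬝ᵥ monoVec d x = 0 := congrFun hc ⟨x, hx⟩
    simp [this]
  have := LinearMap.finrank_le_finrank_of_injective hL
  rwa [Module.finrank_fintype_fun_eq_card, Module.finrank_fintype_fun_eq_card, card_expo,
    Fintype.card_coe] at this

/-! ### Optimality conditions -/

theorem christoffelPoly_eq_trace {n d : ℕ} (q : ℝ) (y : expo n (2 * d) → ℝ) (x : Fin n → ℝ) :
    christoffelPoly q y x =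
      (matPow (momentMatrix y) (q - 1) * momentMatrix (monoVec (2 * d) x)).trace :=
  (trace_mul_momentMatrix_monoVec _ x).symm

theorem christoffelPoly_eq_norm_sq {n d : ℕ} (q : ℝ) {y : expo n (2 * d) → ℝ}
    (hy : (momentMatrix y).PosDef) (x : Fin n → ℝ) :
    christoffelPoly q y x =
      ‖WithLp.toLp 2 ((matPow (momentMatrix y) ((q - 1) / 2)).mulVec (monoVec d x))‖ ^ 2 := by
  set B := matPow (momentMatrix y) ((q - 1) / 2) with hB
  have hBB : matPow (momentMatrix y) (q - 1) = B * B := by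
    rw [hB, matPow_mul hy, add_halves]
  have hBt : B.transpose = B := by
    have := matPow_isHermitian (momentMatrix y) ((q - 1) / 2)
    rwa [Matrix.IsHermitian, Matrix.conjTranspose_eq_transpose_of_trivial] at this
  rw [christoffelPoly, hBB, ← Matrix.mulVec_mulVec, Matrix.dotProduct_mulVec,
    ← Matrix.mulVec_transpose, hBt, EuclideanSpace.real_norm_sq_eq]
  simp [dotProduct, sq]

/-- The necessary optimality conditions, for any optimal solution. -/
theorem isSolution_dual {n d : ℕ} {q : ℝ} (hq : q < 1) {X : Set (Fin n → ℝ)} (hX : IsCompact X)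
    (hint : (interior X).Nonempty) {y : expo n (2 * d) → ℝ} (hy : IsSolution q X y) :
    (momentMatrix y).PosDef ∧ ∀ x ∈ X, 0 ≤ dualPoly q y x := by
  obtain ⟨hyf, hmax⟩ := hy
  rw [feasibleSet_eq_convexHull hX] at hyf hmax
  have hseg : ∀ z ∈ convexHull ℝ (monoVec (2 * d) '' X), ∀ t ∈ Set.Ioo (0 : ℝ) 1,
      phi q ((1 - t) • momentMatrix y + t • momentMatrix z) ≤ phi q (momentMatrix y) := by
    intro z hz t ht
    rw [← isLinearMap_momentMatrix.map_smul, ← isLinearMap_momentMatrix.map_smul,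
      ← isLinearMap_momentMatrix.map_add]
    exact hmax _ (convex_convexHull ℝ _ hyf hz (sub_pos.2 ht.2).le ht.1.le (by ring))
  have hpsd := momentMatrix_posSemidef hyf
  obtain ⟨z, hz, hzp⟩ := exists_posDef_momentMatrix d hint
  have hpd := posDef_of_isMax hq hpsd hzp (hseg z hz)
  refine ⟨hpd, fun x hx => ?_⟩
  have hxm : monoVec (2 * d) x ∈ convexHull ℝ (monoVec (2 * d) '' X) :=
    subset_convexHull ℝ _ ⟨x, hx, rfl⟩
  rw [dualPoly, sub_nonneg, christoffelPoly_eq_trace]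
  exact trace_matPow_mul_le_of_isMax hq hpd (momentMatrix_posSemidef hxm) (hseg _ hxm)

/-- The dual condition is sufficient for optimality, and makes the solution unique. -/
theorem isUniqueSolution_of_dual {n d : ℕ} {q : ℝ} (hq : q < 1) {X : Set (Fin n → ℝ)}
    (hX : IsCompact X) (hint : (interior X).Nonempty) {y : expo n (2 * d) → ℝ}
    (hyf : y ∈ feasibleSet d X) (hpd : (momentMatrix y).PosDef)
    (hdual : ∀ x ∈ X, 0 ≤ dualPoly q y x) : IsUniqueSolution q X y := by
  have hT := trace_matPow_pos hpd q
  have hphi := phi_pos q hpd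
  have hle : ∀ z ∈ feasibleSet d X,
      (matPow (momentMatrix y) (q - 1) * momentMatrix z).trace ≤
        (matPow (momentMatrix y) q).trace := by
    intro z hz
    rw [feasibleSet_eq_convexHull hX] at hz
    refine convexHull_min ?_ (convex_halfSpace_le
      (isLinearMap_trace_mul_momentMatrix (matPow (momentMatrix y) (q - 1)))
      (matPow (momentMatrix y) q).trace) hz
    rintro _ ⟨x, hx, rfl⟩
    have := hdual x hx
    rwa [dualPoly, sub_nonneg, christoffelPoly_eq_trace] at this
  have hpsd : ∀ z ∈ feasibleSet d X, (momentMatrix z).PosSemidef := fun z hz => by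
    rw [feasibleSet_eq_convexHull hX] at hz
    exact momentMatrix_posSemidef hz
  have hsupp : ∀ z ∈ feasibleSet d X,
      supportFunctional q (momentMatrix y) (momentMatrix z) ≤ phi q (momentMatrix y) := fun z hz =>
    mul_le_of_le_one_right hphi.le ((div_le_one hT).2 (hle z hz))
  have hsol : IsSolution q X y := ⟨hyf, fun z hz =>
    (phi_le_support_and_eq hq hpd (hpsd z hz)).1.trans (hsupp z hz)⟩
  refine ⟨hsol, fun z hz => ?_⟩
  have hzf := hz.1
  have hzpd := (isSolution_dual hq hX hint hz).1
  have heq : phi q (momentMatrix z) = phi q (momentMatrix y) :=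
    le_antisymm (hsol.2 z hzf) (hz.2 y hyf)
  have hb := phi_le_support_and_eq hq hpd (hpsd z hzf)
  have hs : supportFunctional q (momentMatrix y) (momentMatrix z) = phi q (momentMatrix y) :=
    le_antisymm (hsupp z hzf) (heq ▸ hb.1)
  have h1 := hb.2 hzpd (heq.trans hs.symm)
  rw [supportFunctional, mul_eq_left₀ hphi.ne'] at hs
  rw [hs, one_smul] at h1
  exact momentMatrix_injective h1

theorem exists_isSolution {n d : ℕ} {q : ℝ} (hq : q < 1) {X : Set (Fin n → ℝ)}
    (hX : IsCompact X) (hne : X.Nonempty) :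
    ∃ y : expo n (2 * d) → ℝ, IsSolution q X y := by
  have husc : UpperSemicontinuousOn (objective (d := d) q)
      (convexHull ℝ (monoVec (2 * d) '' X)) := by
    intro y hy c hc
    have hcont : Continuous
        (momentMatrix : (expo n (2 * d) → ℝ) → Matrix (expo n d) (expo n d) ℝ) :=
      continuous_pi fun α => continuous_pi fun β => continuous_apply _
    have htend : Tendsto momentMatrix (𝓝[convexHull ℝ (monoVec (2 * d) '' X)] y)
        (𝓝[{A | A.PosSemidef}] (momentMatrix y)) :=
      tendsto_nhdsWithin_iff.2 ⟨(hcont.tendsto y).mono_left nhdsWithin_le_nhds,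
        eventually_nhdsWithin_of_forall fun z hz => momentMatrix_posSemidef hz⟩
    exact htend.eventually (upperSemicontinuousOn_phi hq _ (momentMatrix_posSemidef hy) c hc)
  obtain ⟨y, hy, hmax⟩ := husc.exists_isMaxOn ((hne.image _).mono (subset_convexHull ℝ _))
    (isCompact_convexHull (hX.image (continuous_monoVec n (2 * d))))
  exact ⟨y, by rwa [feasibleSet_eq_convexHull hX], fun z hz =>
    hmax (by rwa [feasibleSet_eq_convexHull hX] at hz)⟩

theorem concaveOn_objective {n d : ℕ} {q : ℝ} (hq : q < 1) {X : Set (Fin n → ℝ)}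
    (hX : IsCompact X) : ConcaveOn ℝ (feasibleSet d X) (objective (d := d) q) := by
  rw [feasibleSet_eq_convexHull hX]
  refine ⟨convex_convexHull ℝ _, fun y hy z hz s t hs ht hst => ?_⟩
  have := (concaveOn_phi hq).2 (momentMatrix_posSemidef hy) (momentMatrix_posSemidef hz) hs ht hst
  rwa [← isLinearMap_momentMatrix.map_smul, ← isLinearMap_momentMatrix.map_smul,
    ← isLinearMap_momentMatrix.map_add] at this

/-- Complementary slackness: the mean of the dual polynomial over the atoms is
`trace (M ^ q) - trace (M ^ (q - 1) M) = 0`. -/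
theorem dualPoly_eq_zero_of_atom {n d : ℕ} {q : ℝ} {S : Finset (Fin n → ℝ)}
    {w : (Fin n → ℝ) → ℝ≥0} (hw : ∀ x ∈ S, 0 < w x) (hw1 : ∑ x ∈ S, w x = 1)
    (hpd : (momentMatrix (∑ x ∈ S, (w x : ℝ) • monoVec (2 * d) x)).PosDef)
    (hdual : ∀ x ∈ S, 0 ≤ dualPoly q (∑ x ∈ S, (w x : ℝ) • monoVec (2 * d) x) x) :
    ∀ x ∈ S, dualPoly q (∑ x ∈ S, (w x : ℝ) • monoVec (2 * d) x) x = 0 := by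
  set y := ∑ x ∈ S, (w x : ℝ) • monoVec (2 * d) x with hy
  have hw1' : ∑ x ∈ S, (w x : ℝ) = 1 := by rw [← NNReal.coe_sum, hw1]; rfl
  have hsum : ∑ x ∈ S, (w x : ℝ) * dualPoly q y x = 0 := by
    have h1 : (matPow (momentMatrix y) (q - 1) * momentMatrix y).trace =
        ∑ x ∈ S, (w x : ℝ) * christoffelPoly q y x := by
      have := map_sum (isLinearMap_trace_mul_momentMatrix (n := n) (d := d)
        (matPow (momentMatrix y) (q - 1))).mk' (fun x => (w x : ℝ) • monoVec (2 * d) x) S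
      rw [← hy] at this
      simp only [map_smul, IsLinearMap.mk'_apply, smul_eq_mul] at this
      rw [this]
      exact Finset.sum_congr rfl fun x _ => by rw [christoffelPoly_eq_trace]
    simp only [dualPoly, mul_sub, Finset.sum_sub_distrib]
    rw [← h1, ← Finset.sum_mul, hw1', one_mul, trace_matPow_mul_self hpd, sub_self]
  intro x hx
  have h2 := (Finset.sum_eq_zero_iff_of_nonneg fun x hx =>
    mul_nonneg (w x).2 (hdual x hx)).1 hsum x hx
  exact (mul_eq_zero.1 h2).resolve_left (NNReal.coe_ne_zero.2 (hw x hx).ne')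

end OptimalDesign

open OptimalDesign

theorem theorem1 (n d m : ℕ) (q : ℝ) (hq : q < 1) (g : Fin m → MvPolynomial (Fin n) ℝ)
    (hcompact : IsCompact (OptimalDesign.semialgSet g))
    (hint : (interior (OptimalDesign.semialgSet g)).Nonempty) :
    -- the ideal problem is a convex optimization problem
    (Convex ℝ (OptimalDesign.feasibleSet d (OptimalDesign.semialgSet g)) ∧
      ConcaveOn ℝ (OptimalDesign.feasibleSet d (OptimalDesign.semialgSet g))
        (OptimalDesign.objective (d := d) q)) ∧
    -- it has a unique optimal solution, whose moment matrix is positive definite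
    (∃ ystar : OptimalDesign.expo n (2 * d) → ℝ,
      OptimalDesign.IsUniqueSolution q (OptimalDesign.semialgSet g) ystar ∧
      (OptimalDesign.momentMatrix ystar).PosDef ∧
      -- the two expressions of the polynomial agree
      (∀ x : Fin n → ℝ, OptimalDesign.christoffelPoly q ystar x =
        ‖WithLp.toLp 2 (Matrix.mulVec
          (OptimalDesign.matPow (OptimalDesign.momentMatrix ystar) ((q - 1) / 2))
          (OptimalDesign.monoVec d x))‖ ^ 2) ∧
      -- it is represented by a discrete measure supported in the contact set
      (∃ (S : Finset (Fin n → ℝ)) (w : (Fin n → ℝ) → ℝ≥0),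
        (n + d).choose n ≤ S.card ∧ S.card ≤ (n + 2 * d).choose n ∧
        (∀ x ∈ S, x ∈ OptimalDesign.contactSet q (OptimalDesign.semialgSet g) ystar) ∧
        (∀ x ∈ S, 0 < w x) ∧ ∑ x ∈ S, w x = 1 ∧
        OptimalDesign.IsMomentVector ystar (OptimalDesign.discreteMeasure S w))) ∧
    -- characterization of the optimal solution
    (∀ y : OptimalDesign.expo n (2 * d) → ℝ,
      OptimalDesign.IsUniqueSolution q (OptimalDesign.semialgSet g) y ↔
        (y ∈ OptimalDesign.feasibleSet d (OptimalDesign.semialgSet g) ∧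
          (OptimalDesign.momentMatrix y).PosDef ∧
          ∀ x ∈ OptimalDesign.semialgSet g, 0 ≤ OptimalDesign.dualPoly q y x)) := by
  set X := semialgSet g
  have hchar : ∀ y : expo n (2 * d) → ℝ, IsUniqueSolution q X y ↔
      (y ∈ feasibleSet d X ∧ (momentMatrix y).PosDef ∧ ∀ x ∈ X, 0 ≤ dualPoly q y x) := fun y =>
    ⟨fun h => ⟨h.1.1, isSolution_dual hq hcompact hint h.1⟩,
      fun h => isUniqueSolution_of_dual hq hcompact hint h.1 h.2.1 h.2.2⟩
  obtain ⟨y, hy⟩ := exists_isSolution (d := d) hq hcompact (hint.mono interior_subset)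
  obtain ⟨hpd, hdual⟩ := isSolution_dual hq hcompact hint hy
  have hconc := concaveOn_objective (d := d) hq hcompact
  refine ⟨⟨hconc.1, hconc⟩, ⟨y, (hchar y).2 ⟨hy.1, hpd, hdual⟩, hpd,
    christoffelPoly_eq_norm_sq q hpd, ?_⟩, hchar⟩
  have hyf := hy.1
  rw [feasibleSet_eq_convexHull hcompact] at hyf
  obtain ⟨S, w, hcard, hSX, hw, hw1, rfl⟩ := exists_atoms hyf
  exact ⟨S, w, card_expo_le_of_posDef hpd, hcard,
    fun x hx => ⟨hSX x hx,
      dualPoly_eq_zero_of_atom hw hw1 hpd (fun x hx => hdual x (hSX x hx)) x hx⟩,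
    hw, hw1, isMomentVector_discreteMeasure S w⟩
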